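/- Let $\mathbb T\subset\mathbb R$ be a time scale (a nonempty closed set) with $\sup\mathbb T=\infty$, let $\sigma(t)=\inf\{s\in\mathbb T: s>t\}$ and $\mu(t)=\sigma(t)-t$, and let $A$ be a function on $\mathbb T$ with values in the (real or complex) $n\times n$ matrices which is rd-continuous (continuous at right-dense points, with finite left limits at left-dense points) and regressive ($I+\mu(t)A(t)$ is invertible for every $t\in\mathbb T$). Let $x^\Delta$ denote the delta derivative, let $\int_a^b f(s)\,\Delta s=F(b)-F(a)$ with $F^\Delta=f$ denote the delta integral, and put $\int_a^\infty f(s)\,\Delta s=\lim_{b\to\infty,\,b\in\mathbb T}\int_a^b f(s)\,\Delta s$. Let $a\in\mathbb T$. Suppose that the integrals $$\int_a^\infty A(t)\,\Delta t\qquad\text{and}\qquad \int_a^\infty A(t)\Big(\int_t^\infty A(s)\,\Delta s\Big)\Delta t$$ converge (possibly only conditionally), and that the integral $$\int_a^\infty A(t)\Big(\int_t^\infty A(s)\Big(\int_s^\infty A(\tau)\,\Delta\tau\Big)\Delta s\Big)\Delta t$$ converges absolutely, that is, the integral over $[a,\infty)$ of the norm of its integrand $A(t)\big(\int_t^\infty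 A(s)(\int_s^\infty A(\tau)\,\Delta\tau)\,\Delta s\big)$ converges. Then the system $$x^\Delta=A(t)x,\qquad t\in\mathbb T,$$ is of class (S): every solution $x(t)$ has a finite limit as $t\to\infty$, and for every constant vector $x_\infty$ there is a solution $x(t)$ with $x(t)\to x_\infty$ as $t\to\infty$. -/

import Mathlib

open Filter Topology Set

/- Matrices carry the operator norm induced by the sup norm on vectors (all norms being equivalent,
the choice does not matter for any notion below). -/
attribute [local instance] Matrix.linftyOpNormedAddCommGroup Matrix.linftyOpNormedSpace

namespace TimeScale

/-- A time scale: a nonempty closed subset of the real line. -/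
structure IsTimeScale (T : Set ℝ) : Prop where
  nonempty : T.Nonempty
  isClosed : IsClosed T

/-- The forward jump operator `σ(t) = inf {s ∈ T : s > t}`. It is used only for time scales that
are unbounded above, so that the infimum is over a nonempty set. -/
noncomputable def sigma (T : Set ℝ) (t : ℝ) : ℝ := sInf (T ∩ Ioi t)

/-- The backward jump operator `ρ(t) = sup {s ∈ T : s < t}`, meaningful when some point of `T`
lies to the left of `t`. -/
noncomputable def rho (T : Set ℝ) (t : ℝ) : ℝ := sSup (T ∩ Iio t)

/-- The graininess `μ(t) = σ(t) - t`. -/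
noncomputable def graininess (T : Set ℝ) (t : ℝ) : ℝ := sigma T t - t

/-- `t` is right-dense: `σ(t) = t`. -/
def IsRightDense (T : Set ℝ) (t : ℝ) : Prop := sigma T t = t

/-- `t` is left-dense: `t > inf T` and `ρ(t) = t`. -/
def IsLeftDense (T : Set ℝ) (t : ℝ) : Prop := (T ∩ Iio t).Nonempty ∧ rho T t = t

/-- The filter "`t → ∞` with `t ∈ T`". -/
def atInfty (T : Set ℝ) : Filter ℝ := atTop ⊓ 𝓟 T

section Calculus

variable {E : Type*} [NormedAddCommGroup E]

/-- Rd-continuity on `T`: continuity at right-dense points of `T`, and existence of finite left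
limits at left-dense points of `T`. Only the values of `f` on `T` matter. -/
def RdContinuous (T : Set ℝ) (f : ℝ → E) : Prop :=
  (∀ t ∈ T, IsRightDense T t → ContinuousWithinAt f T t) ∧
  (∀ t ∈ T, IsLeftDense T t → ∃ l : E, Tendsto f (𝓝[T ∩ Iio t] t) (𝓝 l))

variable [NormedSpace ℝ E]

/-- `f` has delta (Hilger) derivative `f'` at `t`: for every `ε > 0` there is a neighbourhood of
`t` in `T` on which `‖f(σ(t)) - f(s) - (σ(t) - s) f'‖ ≤ ε |σ(t) - s|`. -/
def HasDeltaDerivAt (T : Set ℝ) (f : ℝ → E) (f' : E) (t : ℝ) : Prop :=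
  ∀ ε : ℝ, 0 < ε → ∃ δ : ℝ, 0 < δ ∧ ∀ s ∈ T, |s - t| < δ →
    ‖f (sigma T t) - f s - (sigma T t - s) • f'‖ ≤ ε * |sigma T t - s|

/-- `F` is a delta antiderivative of `f` on `T` (a time scale unbounded above). -/
def IsDeltaAntideriv (T : Set ℝ) (F f : ℝ → E) : Prop :=
  ∀ t ∈ T, HasDeltaDerivAt T F (f t) t

/-- The improper delta integral `∫_a^∞ f(s) Δs` converges and has value `I`. The delta integral
`∫_a^b f(s) Δs` is the Cauchy integral `F(b) - F(a)` of a delta antiderivative `F` of `f` (every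
rd-continuous function has one, unique on `T` up to a constant), and the improper integral is its
limit as `b → ∞` in `T`. -/
def HasImproperDeltaIntegral (T : Set ℝ) (f : ℝ → E) (a : ℝ) (I : E) : Prop :=
  ∃ F : ℝ → E, IsDeltaAntideriv T F f ∧ Tendsto (fun b => F b - F a) (atInfty T) (𝓝 I)

/-- The improper delta integral `∫_a^∞ f(s) Δs` converges, possibly only conditionally. -/
def ImproperConverges (T : Set ℝ) (f : ℝ → E) (a : ℝ) : Prop :=
  ∃ I : E, HasImproperDeltaIntegral T f a I

/-- The improper delta integral `∫_a^∞ f(s) Δs` converges absolutely. -/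
def ImproperConvergesAbs (T : Set ℝ) (f : ℝ → E) (a : ℝ) : Prop :=
  ImproperConverges T (fun t => ‖f t‖) a

open Classical in
/-- The value of the improper delta integral `∫_a^∞ f(s) Δs` (by convention `0` if it does not
converge). -/
noncomputable def improperIntegral (T : Set ℝ) (f : ℝ → E) (a : ℝ) : E :=
  if h : ∃ I : E, HasImproperDeltaIntegral T f a I then h.choose else 0

end Calculus

section LinearSystem

variable {𝕜 : Type*} [RCLike 𝕜] {n : ℕ}

/-- The matrix function `A` is regressive: `I + μ(t) A(t)` is invertible for every `t ∈ T`. -/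
def Regressive (T : Set ℝ) (A : ℝ → Matrix (Fin n) (Fin n) 𝕜) : Prop :=
  ∀ t ∈ T, IsUnit (1 + graininess T t • A t)

/-- `x` is a solution on `T` of the linear system `x^Δ = A(t) x`. -/
def IsSolution (T : Set ℝ) (A : ℝ → Matrix (Fin n) (Fin n) 𝕜) (x : ℝ → Fin n → 𝕜) : Prop :=
  ∀ t ∈ T, HasDeltaDerivAt T x ((A t).mulVec (x t)) t

/-- The system `x^Δ = A(t) x` is of class (S): every solution has a limit as `t → ∞`, and every
constant vector is the limit of some solution. -/
def ClassS (T : Set ℝ) (A : ℝ → Matrix (Fin n) (Fin n) 𝕜) : Prop :=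
  (∀ x : ℝ → Fin n → 𝕜, IsSolution T A x →
    ∃ xinf : Fin n → 𝕜, Tendsto x (atInfty T) (𝓝 xinf)) ∧
  (∀ xinf : Fin n → 𝕜, ∃ x : ℝ → Fin n → 𝕜,
    IsSolution T A x ∧ Tendsto x (atInfty T) (𝓝 xinf))

end LinearSystem

end TimeScale

/-!
Write `A₁(t) = ∫_t^∞ A` and `A₂(t) = ∫_t^∞ A A₁`, so that `A₁^Δ = -A` and `A₂^Δ = -A A₁`. The
function `P = 1 - A₁ + A₂` tends to `1` and satisfies `P^Δ = A - A A₁ = A P - A A₂`. Hence the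
substitution `X = P Y` turns `X^Δ = A X` into `Y^Δ = (P^σ)⁻¹ A A₂ Y` wherever `P` is invertible, in
particular for all large `t` (`exists_transformation`), and the coefficient of this system is
absolutely integrable by hypothesis. A mean value inequality shows that a solution of such a system
converges, and that it stays close to its initial value when it is started late enough. So every
matrix solution `X` converges, and some matrix solution has an invertible limit, which can be
normalised to `1`.

The second half of the conclusion also needs solutions that exist on all of the time scale.
Forward in time they are given by the Peano series `1 + ∫ A + ∫ A ∫ A + ⋯`. Its integrals are
Lebesgue integrals over the line, with integrands frozen on the gaps of the time scale
(`hasDeltaDerivAt_integral_lastPoint`, `exists_solution_of_isLeast`). Regressivity makes the values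
of this fundamental solution invertible (`SolvesFrom.isUnit`), which allows backward continuation
(`exists_solution`).

All of this is carried out in a complete normed `ℝ`-algebra. Matrices enter only at the end, where
a vector solution is regarded as a matrix solution with equal columns, and vector solutions are
recovered by applying matrix solutions to constant vectors.
-/

namespace TimeScale

/-! ### Jump operator -/

section Jump

variable {T : Set ℝ}

theorem sigma_le {t s : ℝ} (hs : s ∈ T) (hts : t < s) : sigma T t ≤ s :=
  csInf_le ⟨t, fun _ hx => hx.2.le⟩ ⟨hs, hts⟩

theorem inter_Ioi_nonempty (hb : ¬ BddAbove T) (t : ℝ) : (T ∩ Ioi t).Nonempty := by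
  obtain ⟨s, hs, hts⟩ := not_bddAbove_iff.1 hb t
  exact ⟨s, hs, hts⟩

theorem le_sigma (hb : ¬ BddAbove T) (t : ℝ) : t ≤ sigma T t :=
  le_csInf (inter_Ioi_nonempty hb t) fun _ hx => hx.2.le

theorem sigma_mem (hT : IsClosed T) (hb : ¬ BddAbove T) (t : ℝ) : sigma T t ∈ T := by
  have h : sigma T t ∈ closure (T ∩ Ioi t) :=
    csInf_mem_closure (inter_Ioi_nonempty hb t) ⟨t, fun _ hx => hx.2.le⟩
  exact hT.closure_subset (closure_mono inter_subset_left h)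

theorem exists_mem_Ioo_of_isRightDense (hb : ¬ BddAbove T) {t r : ℝ} (ht : IsRightDense T t)
    (hr : t < r) : ∃ s ∈ T, t < s ∧ s < r := by
  obtain ⟨s, hs, hsr⟩ := exists_lt_of_csInf_lt (inter_Ioi_nonempty hb t)
    (show sInf (T ∩ Ioi t) < r from (ht : sigma T t = t).trans_lt hr)
  exact ⟨s, hs.1, hs.2, hsr⟩

theorem sigma_inter_Ici {b t : ℝ} (hbt : b ≤ t) : sigma (T ∩ Ici b) t = sigma T t := by
  have : T ∩ Ici b ∩ Ioi t = T ∩ Ioi t := by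
    ext s
    simp only [mem_inter_iff, mem_Ici, mem_Ioi]
    constructor
    · rintro ⟨⟨h, -⟩, h'⟩
      exact ⟨h, h'⟩
    · rintro ⟨h, h'⟩
      exact ⟨⟨h, hbt.trans h'.le⟩, h'⟩
  rw [sigma, sigma, this]

theorem not_bddAbove_inter_Ici (hb : ¬ BddAbove T) (b : ℝ) : ¬ BddAbove (T ∩ Ici b) := by
  rw [not_bddAbove_iff] at hb ⊢
  intro x
  obtain ⟨s, hs, hxs⟩ := hb (max x b)
  exact ⟨s, ⟨hs, (le_max_right x b).trans hxs.le⟩, (le_max_left x b).trans_lt hxs⟩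

theorem atInfty_neBot (hb : ¬ BddAbove T) : (atInfty T).NeBot := by
  refine inf_principal_neBot_iff.2 fun U hU => ?_
  obtain ⟨c, hc⟩ := mem_atTop_sets.1 hU
  obtain ⟨s, hs, hcs⟩ := not_bddAbove_iff.1 hb c
  exact ⟨s, hc s hcs.le, hs⟩

/-- An eventual property along `t → ∞` in `T` holds from some point of `T` onwards. -/
theorem exists_of_eventually_atInfty (hb : ¬ BddAbove T) {p : ℝ → Prop}
    (h : ∀ᶠ t in atInfty T, p t) : ∃ t₀ ∈ T, ∀ t ∈ T, t₀ ≤ t → p t := by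
  obtain ⟨c, hc⟩ := eventually_atTop.1 (eventually_inf_principal.1 h)
  obtain ⟨s, hs, hcs⟩ := not_bddAbove_iff.1 hb c
  exact ⟨s, hs, fun t ht hst => hc t (hcs.le.trans hst) ht⟩

theorem eventually_atInfty_ge (b : ℝ) : ∀ᶠ t in atInfty T, t ∈ T ∧ b ≤ t :=
  eventually_inf_principal.2 ((eventually_ge_atTop b).mono fun _ h h' => ⟨h', h⟩)

end Jump

/-! ### Rules for the delta derivative -/

section Derivative

variable {E : Type*} [NormedAddCommGroup E] [NormedSpace ℝ E] {T : Set ℝ} {f g : ℝ → E}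
  {f' g' : E} {t : ℝ}

theorem hasDeltaDerivAt_iff_isLittleO :
    HasDeltaDerivAt T f f' t ↔
      (fun s => f (sigma T t) - f s - (sigma T t - s) • f') =o[𝓝[T] t]
        fun s => sigma T t - s := by
  rw [Asymptotics.isLittleO_iff, HasDeltaDerivAt]
  refine forall_congr' fun ε => forall_congr' fun _ => ?_
  rw [Metric.nhdsWithin_basis_ball.eventually_iff]
  refine exists_congr fun δ => and_congr_right fun _ => ?_
  simp only [mem_inter_iff, Metric.mem_ball, Real.dist_eq, Real.norm_eq_abs]
  exact ⟨fun h s hs => h s hs.2 hs.1, fun h s hs hd => h ⟨hd, hs⟩⟩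

namespace HasDeltaDerivAt

/-- The defining estimate at `s = t` forces equality, since `ε` is arbitrary. -/
theorem sigma_eq (h : HasDeltaDerivAt T f f' t) (ht : t ∈ T) :
    f (sigma T t) = f t + (sigma T t - t) • f' := by
  have key : ‖f (sigma T t) - f t - (sigma T t - t) • f'‖ ≤ 0 := by
    refine le_of_forall_pos_le_add fun ε hε => ?_
    have hpos : 0 < |sigma T t - t| + 1 := by positivity
    obtain ⟨δ, hδ, H⟩ := h (ε / (|sigma T t - t| + 1)) (by positivity)
    have := H t ht (by simpa using hδ)
    refine this.trans ?_
    rw [zero_add, div_mul_eq_mul_div, div_le_iff₀ hpos]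
    nlinarith
  have := norm_le_zero_iff.1 key
  rw [sub_sub, sub_eq_zero] at this
  exact this

theorem continuousWithinAt (h : HasDeltaDerivAt T f f' t) (ht : t ∈ T) :
    ContinuousWithinAt f T t := by
  have hid : Tendsto (fun s : ℝ => sigma T t - s) (𝓝[T] t) (𝓝 (sigma T t - t)) :=
    ((continuous_const.sub continuous_id).tendsto t).mono_left nhdsWithin_le_nhds
  have h1 : Tendsto (fun s => f (sigma T t) - f s - (sigma T t - s) • f') (𝓝[T] t) (𝓝 0) := by
    refine ((hasDeltaDerivAt_iff_isLittleO.1 h).trans_isBigO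
      (hid.isBigO_one ℝ)).tendsto_zero_of_tendsto (tendsto_const_nhds (x := (1 : ℝ)))
  have h2 := (tendsto_const_nhds (x := f (sigma T t))).sub (h1.add (hid.smul_const f'))
  have h3 : f (sigma T t) - (0 + (sigma T t - t) • f') = f t := by
    rw [h.sigma_eq ht]; abel
  rw [h3] at h2
  exact h2.congr fun s => by abel

theorem congr_of_eqOn (h : HasDeltaDerivAt T f f' t) (hfg : EqOn g f T) (hσ : sigma T t ∈ T) :
    HasDeltaDerivAt T g f' t := by
  intro ε hε
  obtain ⟨δ, hδ, H⟩ := h ε hε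
  refine ⟨δ, hδ, fun s hs hd => ?_⟩
  rw [hfg hs, hfg hσ]
  exact H s hs hd

theorem sub (hf : HasDeltaDerivAt T f f' t) (hg : HasDeltaDerivAt T g g' t) :
    HasDeltaDerivAt T (fun s => f s - g s) (f' - g') t := by
  rw [hasDeltaDerivAt_iff_isLittleO] at *
  refine (hf.sub hg).congr_left fun s => ?_
  rw [smul_sub]; abel

theorem add (hf : HasDeltaDerivAt T f f' t) (hg : HasDeltaDerivAt T g g' t) :
    HasDeltaDerivAt T (fun s => f s + g s) (f' + g') t := by
  rw [hasDeltaDerivAt_iff_isLittleO] at *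
  refine (hf.add hg).congr_left fun s => ?_
  rw [smul_add]; abel

theorem clm_comp {F : Type*} [NormedAddCommGroup F] [NormedSpace ℝ F] (L : E →L[ℝ] F)
    (hf : HasDeltaDerivAt T f f' t) : HasDeltaDerivAt T (fun s => L (f s)) (L f') t := by
  rw [hasDeltaDerivAt_iff_isLittleO] at *
  refine ((L.isBigO_comp _ _).trans_isLittleO hf).congr_left fun s => ?_
  simp

theorem inter_Ici {b : ℝ} (hf : HasDeltaDerivAt T f f' t) (hbt : b ≤ t) :
    HasDeltaDerivAt (T ∩ Ici b) f f' t := by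
  rw [hasDeltaDerivAt_iff_isLittleO] at *
  rw [sigma_inter_Ici hbt]
  exact hf.mono (nhdsWithin_mono _ inter_subset_left)

/-- Discarding the points of `T` to the left of `b` loses nothing at `t` if `b < t`, or if there are
no such points. -/
theorem of_inter_Ici {b : ℝ} (hf : HasDeltaDerivAt (T ∩ Ici b) f f' t) (hbt : b ≤ t)
    (h : b < t ∨ T ⊆ Ici b) : HasDeltaDerivAt T f f' t := by
  rw [hasDeltaDerivAt_iff_isLittleO] at *
  rw [sigma_inter_Ici hbt] at hf
  refine hf.mono ?_
  rcases h with h | h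
  · exact (nhdsWithin_inter_of_mem' (mem_nhdsWithin_of_mem_nhds (Ici_mem_nhds h))).ge
  · rw [inter_eq_left.2 h]

end HasDeltaDerivAt

theorem hasDeltaDerivAt_const (c : E) : HasDeltaDerivAt T (fun _ => c) 0 t := by
  rw [hasDeltaDerivAt_iff_isLittleO]
  simp

theorem hasDeltaDerivAt_mul_const (M : ℝ) : HasDeltaDerivAt T (fun s => M * s) M t := by
  rw [hasDeltaDerivAt_iff_isLittleO]
  refine (Asymptotics.isLittleO_zero _ _).congr_left fun s => ?_
  rw [smul_eq_mul]; ring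

/-- At a right-scattered point continuity already gives the delta derivative, which is the
difference quotient over the gap. -/
theorem hasDeltaDerivAt_of_sigma_ne (hf : ContinuousWithinAt f T t) (hσ : sigma T t ≠ t)
    (hf' : f (sigma T t) = f t + (sigma T t - t) • f') : HasDeltaDerivAt T f f' t := by
  rw [hasDeltaDerivAt_iff_isLittleO]
  have hid : Tendsto (fun s : ℝ => sigma T t - s) (𝓝[T] t) (𝓝 (sigma T t - t)) :=
    ((continuous_const.sub continuous_id).tendsto t).mono_left nhdsWithin_le_nhds
  have hO : (fun _ => (1 : ℝ)) =O[𝓝[T] t] fun s => sigma T t - s :=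
    (Asymptotics.isBigO_const_const (1 : ℝ) (sub_ne_zero.2 hσ) _).trans
      ((Asymptotics.isEquivalent_const_iff_tendsto (sub_ne_zero.2 hσ)).2 hid).symm.isBigO
  refine Asymptotics.IsLittleO.trans_isBigO ?_ hO
  rw [Asymptotics.isLittleO_one_iff]
  have := ((tendsto_const_nhds (x := f (sigma T t))).sub hf).sub (hid.smul_const f')
  have h0 : f (sigma T t) - f t - (sigma T t - t) • f' = 0 := by rw [hf']; abel
  rwa [h0] at this

end Derivative

/-! ### Mean value inequality -/

section MeanValue

variable {E : Type*} [NormedAddCommGroup E] [NormedSpace ℝ E] {T : Set ℝ} {f f' : ℝ → E}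
  {G g : ℝ → ℝ} {b c : ℝ}

/-- The mean value inequality, by induction over `T ∩ [b, c]`: the estimate with an extra term
`ε (t - b)` is a closed condition, and it passes from a point to a larger one. -/
theorem norm_sub_le_of_hasDeltaDerivAt (hT : IsClosed T) (hub : ¬ BddAbove T) (hb : b ∈ T)
    (hc : c ∈ T) (hbc : b ≤ c) (hf : ∀ t ∈ T, b ≤ t → t ≤ c → HasDeltaDerivAt T f (f' t) t)
    (hG : ∀ t ∈ T, b ≤ t → t ≤ c → HasDeltaDerivAt T G (g t) t)
    (hfg : ∀ t ∈ T, b ≤ t → t ≤ c → ‖f' t‖ ≤ g t) :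
    ‖f c - f b‖ ≤ G c - G b := by
  have main : ∀ ε : ℝ, 0 < ε → ‖f c - f b‖ ≤ G c - G b + ε * (c - b) := by
    intro ε hε
    set s : Set ℝ := {t | t ∈ T ∧ ‖f t - f b‖ ≤ G t - G b + ε * (t - b)} with hs
    have hK : IsClosed (T ∩ Icc b c) := hT.inter isClosed_Icc
    have hfc : ContinuousOn f (T ∩ Icc b c) := fun t ht =>
      ((hf t ht.1 ht.2.1 ht.2.2).continuousWithinAt ht.1).mono inter_subset_left
    have hGc : ContinuousOn G (T ∩ Icc b c) := fun t ht =>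
      ((hG t ht.1 ht.2.1 ht.2.2).continuousWithinAt ht.1).mono inter_subset_left
    have hclosed : IsClosed (s ∩ Icc b c) := by
      have : s ∩ Icc b c =
          {t ∈ T ∩ Icc b c | ‖f t - f b‖ ≤ G t - G b + ε * (t - b)} := by
        ext t; simp only [hs, mem_inter_iff, mem_ofPred_eq]; tauto
      rw [this]
      exact hK.isClosed_le (hfc.sub continuousOn_const).norm
        ((hGc.sub continuousOn_const).add (by fun_prop))
    refine (hclosed.mem_of_ge_of_forall_exists_gt ⟨hb, by simp⟩ hbc ?_).2
    rintro x ⟨⟨hxT, hx⟩, hbx, hxc⟩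
    have hfx := hf x hxT hbx hxc.le
    have hGx := hG x hxT hbx hxc.le
    have hle := hfg x hxT hbx hxc.le
    by_cases hd : sigma T x = x
    · have h1 := (hasDeltaDerivAt_iff_isLittleO.1 hfx).def (half_pos hε)
      have h2 := (hasDeltaDerivAt_iff_isLittleO.1 hGx).def (half_pos hε)
      obtain ⟨δ, hδ, H⟩ := (Metric.nhdsWithin_basis_ball.eventually_iff).1 (h1.and h2)
      obtain ⟨y, hyT, hxy, hy⟩ := exists_mem_Ioo_of_isRightDense hub hd
        (lt_min hxc (lt_add_of_pos_right x hδ))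
      have hyc : y < c := hy.trans_le (min_le_left _ _)
      have hyd : y < x + δ := hy.trans_le (min_le_right _ _)
      obtain ⟨H1, H2⟩ := H (x := y) ⟨by
        rw [Metric.mem_ball, Real.dist_eq, abs_of_pos (sub_pos.2 hxy)]; linarith, hyT⟩
      rw [hd] at H1 H2
      simp only [Real.norm_eq_abs, smul_eq_mul] at H1 H2
      rw [abs_of_neg (sub_neg.2 hxy)] at H1 H2
      refine ⟨y, ⟨hyT, ?_⟩, hxy, hyc.le⟩
      have e : f y - f b = (f x - f b) - (f x - f y - (x - y) • f' x) + (y - x) • f' x := by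
        rw [sub_smul, sub_smul]; abel
      have hsm : ‖(y - x) • f' x‖ ≤ (y - x) * g x := by
        rw [norm_smul, Real.norm_eq_abs, abs_of_pos (sub_pos.2 hxy)]
        exact mul_le_mul_of_nonneg_left hle (sub_pos.2 hxy).le
      have h3 : ‖f y - f b‖ ≤ ‖f x - f b‖ + ‖f x - f y - (x - y) • f' x‖
          + ‖(y - x) • f' x‖ := by
        rw [e]; exact (norm_add_le _ _).trans (by gcongr; exact norm_sub_le _ _)
      have := (abs_le.1 H2).2
      have := (abs_le.1 H2).1
      linarith
    · have hlt : x < sigma T x := lt_of_le_of_ne (le_sigma hub x) (Ne.symm hd)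
      refine ⟨sigma T x, ⟨sigma_mem hT hub x, ?_⟩, hlt, sigma_le hc hxc⟩
      rw [hfx.sigma_eq hxT, hGx.sigma_eq hxT, smul_eq_mul, add_sub_right_comm]
      have hsm : ‖(sigma T x - x) • f' x‖ ≤ (sigma T x - x) * g x := by
        rw [norm_smul, Real.norm_eq_abs, abs_of_pos (sub_pos.2 hlt)]
        exact mul_le_mul_of_nonneg_left hle (sub_pos.2 hlt).le
      have := norm_add_le (f x - f b) ((sigma T x - x) • f' x)
      nlinarith
  refine le_of_forall_pos_le_add fun ε hε => ?_
  have hcb : 0 < c - b + 1 := by linarith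
  refine (main (ε / (c - b + 1)) (by positivity)).trans ?_
  gcongr
  rw [div_mul_eq_mul_div, div_le_iff₀ hcb]
  nlinarith

/-- If `‖f^Δ‖ ≤ g ‖f‖` and the integral of `g` over `[b, c]` is at most `1/2`, then `f` varies on
`[b, c]` by at most `2 ‖f b‖` times that integral; this plays the role of Gronwall's
inequality. -/
theorem norm_sub_le_of_norm_deriv_le_mul (hT : IsClosed T) (hub : ¬ BddAbove T) (hb : b ∈ T)
    (hc : c ∈ T) (hbc : b ≤ c) (hf : ∀ t ∈ T, b ≤ t → t ≤ c → HasDeltaDerivAt T f (f' t) t)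
    (hG : ∀ t ∈ T, b ≤ t → t ≤ c → HasDeltaDerivAt T G (g t) t)
    (hfg : ∀ t ∈ T, b ≤ t → t ≤ c → ‖f' t‖ ≤ g t * ‖f t‖)
    (hg : ∀ t ∈ T, b ≤ t → t ≤ c → 0 ≤ g t) (hsmall : G c - G b ≤ 1 / 2) :
    ‖f c - f b‖ ≤ 2 * (G c - G b) * ‖f b‖ := by
  have hmono : ∀ t ∈ T, b ≤ t → t ≤ c → G t ≤ G c := by
    intro t ht hbt htc
    have := norm_sub_le_of_hasDeltaDerivAt (f := fun _ => (0 : ℝ)) (f' := fun _ => 0)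
      hT hub ht hc htc (fun _ _ _ _ => hasDeltaDerivAt_const 0)
      (fun s hs h1 h2 => hG s hs (hbt.trans h1) h2)
      (fun s hs h1 h2 => by simpa using hg s hs (hbt.trans h1) h2)
    simp only [sub_self, norm_zero] at this
    linarith
  have hK : IsCompact (T ∩ Icc b c) := isCompact_Icc.inter_left hT
  have hfc : ContinuousOn (fun t => ‖f t‖) (T ∩ Icc b c) := fun t ht =>
    (((hf t ht.1 ht.2.1 ht.2.2).continuousWithinAt ht.1).mono inter_subset_left).norm
  -- Apply the mean value inequality with the maximum `‖f m‖` of `‖f‖`, and absorb it for `t = m`.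
  obtain ⟨m, ⟨hmT, hbm, hmc⟩, hm⟩ := hK.exists_isMaxOn ⟨b, hb, le_rfl, hbc⟩ hfc
  have hbound : ∀ t ∈ T, b ≤ t → t ≤ c → ‖f t‖ ≤ ‖f m‖ := fun t h1 h2 h3 => hm ⟨h1, h2, h3⟩
  have hest : ∀ t ∈ T, b ≤ t → t ≤ c → ‖f t - f b‖ ≤ ‖f m‖ * (G t - G b) := by
    intro t ht hbt htc
    have := norm_sub_le_of_hasDeltaDerivAt (f := f) (f' := f') (G := fun s => ‖f m‖ * G s)
      (g := fun s => ‖f m‖ * g s) hT hub hb ht hbt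
      (fun s hs h1 h2 => hf s hs h1 (h2.trans htc))
      (fun s hs h1 h2 => (hG s hs h1 (h2.trans htc)).clm_comp
        (ContinuousLinearMap.mul ℝ ℝ ‖f m‖))
      (fun s hs h1 h2 => (hfg s hs h1 (h2.trans htc)).trans (by
        rw [mul_comm]
        exact mul_le_mul_of_nonneg_right (hbound s hs h1 (h2.trans htc))
          (hg s hs h1 (h2.trans htc))))
    rwa [← mul_sub] at this
  have h1 := hest m hmT hbm hmc
  have h2 := hest c hc hbc le_rfl
  have h3 := hmono m hmT hbm hmc
  have h4 := hmono b hb le_rfl hbc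
  have h5 : ‖f m‖ ≤ ‖f b‖ + ‖f m - f b‖ := by
    have := norm_add_le (f b) (f m - f b)
    rwa [add_sub_cancel] at this
  have h6 : ‖f m‖ ≤ 2 * ‖f b‖ := by
    have : ‖f m‖ * (G m - G b) ≤ ‖f m‖ * (1 / 2) := by gcongr; linarith
    linarith
  calc ‖f c - f b‖ ≤ ‖f m‖ * (G c - G b) := h2
    _ ≤ 2 * ‖f b‖ * (G c - G b) := by gcongr
    _ = _ := by ring

/-- Two functions with the same delta derivative differ by a constant. -/
theorem IsDeltaAntideriv.sub_eq_sub (hT : IsClosed T) (hub : ¬ BddAbove T) {F₁ F₂ h : ℝ → E}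
    (h₁ : IsDeltaAntideriv T F₁ h) (h₂ : IsDeltaAntideriv T F₂ h) (hb : b ∈ T) (hc : c ∈ T) :
    F₁ c - F₁ b = F₂ c - F₂ b := by
  wlog hbc : b ≤ c generalizing b c
  · rw [← neg_sub (F₁ b), ← neg_sub (F₂ b), this hc hb (le_of_not_ge hbc)]
  have := norm_sub_le_of_hasDeltaDerivAt (f := fun t => F₁ t - F₂ t) (f' := fun _ => 0)
    (G := fun _ => 0) (g := fun _ => 0) hT hub hb hc hbc
    (fun t ht _ _ => by simpa using (h₁ t ht).sub (h₂ t ht))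
    (fun _ _ _ _ => hasDeltaDerivAt_const 0) (fun _ _ _ _ => by simp)
  rw [sub_self] at this
  have := norm_le_zero_iff.1 this
  rw [sub_sub_sub_comm] at this
  exact sub_eq_zero.1 this

end MeanValue

/-! ### Tails of improper integrals -/

section Tail

variable {E : Type*} [NormedAddCommGroup E] [NormedSpace ℝ E] {T : Set ℝ} {f : ℝ → E} {a : ℝ}

theorem HasImproperDeltaIntegral.tendsto {F : ℝ → E} {I : E} {t : ℝ} (hT : IsClosed T)
    (hub : ¬ BddAbove T) (ht : t ∈ T) (hF : IsDeltaAntideriv T F f)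
    (h : HasImproperDeltaIntegral T f t I) : Tendsto (fun b => F b - F t) (atInfty T) (𝓝 I) := by
  obtain ⟨F₁, hF₁, hlim⟩ := h
  refine hlim.congr' ((eventually_atInfty_ge t).mono fun b hb => ?_)
  exact hF₁.sub_eq_sub hT hub hF ht hb.1

/-- The tail `t ↦ ∫_t^∞ f` of a convergent improper integral tends to zero and has delta
derivative `-f`. -/
theorem ImproperConverges.improperIntegral_tail (hT : IsClosed T) (hub : ¬ BddAbove T)
    (h : ImproperConverges T f a) :
    IsDeltaAntideriv T (improperIntegral T f) (fun t => -f t) ∧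
      Tendsto (improperIntegral T f) (atInfty T) (𝓝 0) := by
  obtain ⟨I, F, hF, hlim⟩ := h
  have hlim' : Tendsto F (atInfty T) (𝓝 (I + F a)) := by
    simpa using hlim.add_const (F a)
  have heq : EqOn (improperIntegral T f) (fun t => I + F a - F t) T := by
    intro t ht
    have hex : ∃ J : E, HasImproperDeltaIntegral T f t J :=
      ⟨I + F a - F t, F, hF, hlim'.sub_const _⟩
    have hval : improperIntegral T f t = hex.choose := by
      rw [improperIntegral, dif_pos hex]
    rw [hval]
    have := atInfty_neBot hub
    exact tendsto_nhds_unique (hex.choose_spec.tendsto hT hub ht hF) (hlim'.sub_const _)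
  constructor
  · intro t ht
    refine HasDeltaDerivAt.congr_of_eqOn ?_ heq (sigma_mem hT hub t)
    simpa using (hasDeltaDerivAt_const (I + F a)).sub (hF t ht)
  · have h0 : Tendsto (fun t => I + F a - F t) (atInfty T) (𝓝 0) := by
      simpa using hlim'.const_sub (I + F a)
    exact h0.congr' ((eventually_atInfty_ge a).mono fun t ht => (heq ht.1).symm)

end Tail

/-! ### Rd-continuous functions -/

section RdContinuous

variable {E : Type*} [NormedAddCommGroup E] {T : Set ℝ} {f : ℝ → E}

theorem IsRightDense.of_inter_Ici {b t : ℝ} (hbt : b ≤ t) (h : IsRightDense (T ∩ Ici b) t) :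
    IsRightDense T t := by
  rwa [IsRightDense, sigma_inter_Ici hbt] at h

theorem IsLeftDense.of_inter_Ici {b t : ℝ} (h : IsLeftDense (T ∩ Ici b) t) :
    IsLeftDense T t := by
  obtain ⟨hne, hρ⟩ := h
  have hsub : T ∩ Ici b ∩ Iio t ⊆ T ∩ Iio t := inter_subset_inter_left _ inter_subset_left
  refine ⟨hne.mono hsub, le_antisymm ?_ ?_⟩
  · exact csSup_le (hne.mono hsub) fun x hx => hx.2.le
  · exact hρ.ge.trans (csSup_le_csSup ⟨t, fun x hx => hx.2.le⟩ hne hsub)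

theorem RdContinuous.inter_Ici (hf : RdContinuous T f) (b : ℝ) :
    RdContinuous (T ∩ Ici b) f := by
  refine ⟨fun t ht hd => ?_, fun t ht hd => ?_⟩
  · exact (hf.1 t ht.1 (hd.of_inter_Ici ht.2)).mono inter_subset_left
  · obtain ⟨l, hl⟩ := hf.2 t ht.1 hd.of_inter_Ici
    exact ⟨l, hl.mono_left (nhdsWithin_mono _ (inter_subset_inter_left _ inter_subset_left))⟩

theorem nhdsWithin_inter_Ioi_eq_bot (hub : ¬ BddAbove T) {t : ℝ} (h : ¬ IsRightDense T t) :
    𝓝[T ∩ Ioi t] t = ⊥ := by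
  have hlt : t < sigma T t := lt_of_le_of_ne (le_sigma hub t) (Ne.symm h)
  rw [← empty_mem_iff_bot]
  filter_upwards [self_mem_nhdsWithin, mem_nhdsWithin_of_mem_nhds (Iio_mem_nhds hlt)] with s hs hs'
  exact absurd (sigma_le hs.1 hs.2) (not_le.2 hs')

theorem nhdsWithin_inter_Iio_eq_bot {t : ℝ} (h : ¬ IsLeftDense T t) :
    𝓝[T ∩ Iio t] t = ⊥ := by
  by_cases hne : (T ∩ Iio t).Nonempty
  · have hbdd : BddAbove (T ∩ Iio t) := ⟨t, fun x hx => hx.2.le⟩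
    have hle : rho T t ≤ t := csSup_le hne fun x hx => hx.2.le
    have hlt : rho T t < t := lt_of_le_of_ne hle fun h' => h ⟨hne, h'⟩
    rw [← empty_mem_iff_bot]
    filter_upwards [self_mem_nhdsWithin, mem_nhdsWithin_of_mem_nhds (Ioi_mem_nhds hlt)]
      with s hs hs'
    exact absurd (le_csSup hbdd hs) (not_le.2 hs')
  · rw [not_nonempty_iff_eq_empty.1 hne, nhdsWithin_empty]

theorem RdContinuous.exists_eventually_norm_le (hub : ¬ BddAbove T) (hf : RdContinuous T f)
    {t : ℝ} (ht : t ∈ T) : ∃ M, ∀ᶠ s in 𝓝[T] t, ‖f s‖ ≤ M := by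
  by_cases hr : IsRightDense T t
  · obtain ⟨M, hM⟩ := (hf.1 t ht hr).norm.isBoundedUnder_le
    exact ⟨M, hM⟩
  · have hleft : ∃ M, ∀ᶠ s in 𝓝[T ∩ Iio t] t, ‖f s‖ ≤ M := by
      by_cases hl : IsLeftDense T t
      · obtain ⟨l, hl⟩ := hf.2 t ht hl
        obtain ⟨M, hM⟩ := hl.norm.isBoundedUnder_le
        exact ⟨M, hM⟩
      · rw [nhdsWithin_inter_Iio_eq_bot hl]
        exact ⟨0, eventually_bot⟩
    obtain ⟨M, hM⟩ := hleft
    refine ⟨max M ‖f t‖, ?_⟩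
    have hT : T ⊆ T ∩ Iio t ∪ {t} ∪ T ∩ Ioi t := by
      intro s hs
      rcases lt_trichotomy s t with h | h | h
      · exact Or.inl (Or.inl ⟨hs, h⟩)
      · exact Or.inl (Or.inr h)
      · exact Or.inr ⟨hs, h⟩
    refine (nhdsWithin_mono t hT) ?_
    rw [nhdsWithin_union, nhdsWithin_union, nhdsWithin_inter_Ioi_eq_bot hub hr, sup_bot_eq,
      nhdsWithin_singleton]
    exact mem_sup.2 ⟨hM.mono fun s hs => hs.trans (le_max_left _ _), le_max_right M ‖f t‖⟩

/-- An rd-continuous function is bounded on compact intervals. -/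
theorem RdContinuous.exists_norm_le (hT : IsClosed T) (hub : ¬ BddAbove T)
    (hf : RdContinuous T f) (b c : ℝ) :
    ∃ M, 0 ≤ M ∧ ∀ t ∈ T, b ≤ t → t ≤ c → ‖f t‖ ≤ M := by
  have hK : IsCompact (T ∩ Icc b c) := isCompact_Icc.inter_left hT
  have : ∃ M, ∀ t ∈ T ∩ Icc b c, ‖f t‖ ≤ M := by
    refine hK.induction_on (p := fun s => ∃ M, ∀ t ∈ s, ‖f t‖ ≤ M) ⟨0, by simp⟩ ?_ ?_ ?_
    · rintro s s' hss ⟨M, hM⟩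
      exact ⟨M, fun t ht => hM t (hss ht)⟩
    · rintro s s' ⟨M, hM⟩ ⟨M', hM'⟩
      refine ⟨max M M', fun t ht => ?_⟩
      rcases ht with ht | ht
      · exact (hM t ht).trans (le_max_left _ _)
      · exact (hM' t ht).trans (le_max_right _ _)
    · intro x hx
      obtain ⟨M, hM⟩ := hf.exists_eventually_norm_le hub hx.1
      exact ⟨_, nhdsWithin_mono x inter_subset_left hM, M, fun t ht => ht⟩
  obtain ⟨M, hM⟩ := this
  exact ⟨max M 0, le_max_right _ _, fun t ht h1 h2 => (hM t ⟨ht, h1, h2⟩).trans (le_max_left _ _)⟩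

/-- An rd-continuous function can fail to be continuous only at right-scattered points, and these
are countably many. -/
theorem RdContinuous.measurable_indicator [MeasurableSpace E] [BorelSpace E] (hT : IsClosed T)
    (hub : ¬ BddAbove T) (hf : RdContinuous T f) : Measurable (T.indicator f) := by
  classical
  set C : Set ℝ := {t ∈ T | 𝓝[T ∩ Ioi t] t = ⊥} with hC
  have hCc : C.Countable := countable_setOfPred_isolated_right_within
  have hm : MeasurableSet (T \ C) := hT.measurableSet.diff hCc.measurableSet
  have hcont : ContinuousOn f (T \ C) := by
    intro t ht
    refine (hf.1 t ht.1 ?_).mono sdiff_subset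
    by_contra h
    exact ht.2 ⟨ht.1, nhdsWithin_inter_Ioi_eq_bot hub h⟩
  have h1 : Measurable ((T \ C).indicator f) := by
    rw [← piecewise_eq_indicator]
    exact hcont.measurable_piecewise continuousOn_const hm
  refine h1.measurable_of_countable_ne (hCc.mono fun t ht => ?_)
  by_contra htC
  refine ht ?_
  by_cases htT : t ∈ T
  · rw [indicator_of_mem htT, indicator_of_mem (show t ∈ T \ C from ⟨htT, htC⟩)]
  · rw [indicator_of_notMem htT, indicator_of_notMem fun h => htT h.1]

end RdContinuous

/-! ### Antiderivatives -/

section LastPoint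

variable {T : Set ℝ} {b : ℝ}

/-- The last point of `T` that is at most `u`. The maximum with `b` makes this meaningful for all
real `u` when `b` is the least element of `T`; the value is then `b` for `u ≤ b`. -/
noncomputable def lastPoint (T : Set ℝ) (b u : ℝ) : ℝ := sSup (T ∩ Iic (max b u))

theorem bddAbove_inter_Iic (T : Set ℝ) (u : ℝ) : BddAbove (T ∩ Iic u) := ⟨u, fun _ h => h.2⟩

theorem le_lastPoint {s u : ℝ} (hs : s ∈ T) (hsu : s ≤ u) : s ≤ lastPoint T b u :=
  le_csSup (bddAbove_inter_Iic _ _) ⟨hs, hsu.trans (le_max_right _ _)⟩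

theorem lastPoint_mem_inter (hT : IsClosed T) (hb : b ∈ T) (u : ℝ) :
    lastPoint T b u ∈ T ∩ Iic (max b u) :=
  (hT.inter isClosed_Iic).csSup_mem ⟨b, hb, mem_Iic.2 (le_max_left _ _)⟩ (bddAbove_inter_Iic _ _)

theorem lastPoint_mem (hT : IsClosed T) (hb : b ∈ T) (u : ℝ) : lastPoint T b u ∈ T :=
  (lastPoint_mem_inter hT hb u).1

theorem le_lastPoint_left (hb : b ∈ T) (u : ℝ) : b ≤ lastPoint T b u :=
  le_csSup (bddAbove_inter_Iic _ _) ⟨hb, mem_Iic.2 (le_max_left _ _)⟩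

theorem lastPoint_le (hT : IsClosed T) (hb : b ∈ T) {u : ℝ} (hbu : b ≤ u) :
    lastPoint T b u ≤ u := by
  simpa [hbu] using (lastPoint_mem_inter hT hb u).2

theorem monotone_lastPoint (hb : b ∈ T) : Monotone (lastPoint T b) := fun _ _ huv =>
  csSup_le_csSup (bddAbove_inter_Iic _ _) ⟨b, hb, mem_Iic.2 (le_max_left _ _)⟩
    (inter_subset_inter_right _ (Iic_subset_Iic.2 (max_le_max le_rfl huv)))

theorem lastPoint_of_mem_Ico (hT : IsClosed T) (hb : IsLeast T b) {t u : ℝ} (ht : t ∈ T)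
    (htu : t ≤ u) (hu : u < sigma T t) : lastPoint T b u = t := by
  refine le_antisymm (le_of_not_gt fun h => ?_) (le_lastPoint ht htu)
  exact absurd (sigma_le (lastPoint_mem hT hb.1 u) h)
    (not_le.2 ((lastPoint_le hT hb.1 ((hb.2 ht).trans htu)).trans_lt hu))

end LastPoint

section Antiderivative

open MeasureTheory

variable {E : Type*} [NormedAddCommGroup E] {T : Set ℝ} {f : ℝ → E} {b : ℝ}

theorem intervalIntegrable_of_locally_bounded {g : ℝ → E}
    (hg : AEStronglyMeasurable g volume) (hbd : ∀ d, ∃ M, ∀ u ≤ d, ‖g u‖ ≤ M) (c d : ℝ) :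
    IntervalIntegrable g volume c d := by
  obtain ⟨M, hM⟩ := hbd (max c d)
  refine (intervalIntegrable_const (c := M)).mono_fun hg.restrict ?_
  filter_upwards [ae_restrict_mem measurableSet_uIoc] with u hu
  exact (hM u hu.2).trans (le_abs_self M)

theorem RdContinuous.exists_norm_lastPoint_le (hT : IsClosed T) (hub : ¬ BddAbove T) (hb : b ∈ T)
    (hf : RdContinuous T f) (d : ℝ) : ∃ M, 0 ≤ M ∧ ∀ u ≤ d, ‖f (lastPoint T b u)‖ ≤ M := by
  obtain ⟨M, hM0, hM⟩ := hf.exists_norm_le hT hub b (max b d)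
  exact ⟨M, hM0, fun u hu => hM _ (lastPoint_mem hT hb u) (le_lastPoint_left hb u)
    ((lastPoint_mem_inter hT hb u).2.trans (max_le_max le_rfl hu))⟩

theorem RdContinuous.aestronglyMeasurable_comp_lastPoint [SecondCountableTopology E]
    (hT : IsClosed T) (hub : ¬ BddAbove T) (hb : b ∈ T) (hf : RdContinuous T f) :
    AEStronglyMeasurable (fun u => f (lastPoint T b u)) volume := by
  borelize E
  have h := (hf.measurable_indicator hT hub).comp (monotone_lastPoint hb).measurable
  have heq : T.indicator f ∘ lastPoint T b = fun u => f (lastPoint T b u) :=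
    funext fun u => indicator_of_mem (lastPoint_mem hT hb u) f
  rw [heq] at h
  exact h.aestronglyMeasurable

variable [NormedSpace ℝ E] [CompleteSpace E]

/-- Freezing `f` on each gap of `T` at its value at the left end of the gap, the Lebesgue integral
of the resulting function on the line is a delta antiderivative of `f`. -/
theorem hasDeltaDerivAt_integral_lastPoint (hT : IsClosed T) (hub : ¬ BddAbove T)
    (hb : IsLeast T b) (hint : ∀ c d, IntervalIntegrable (fun u => f (lastPoint T b u)) volume c d)
    {t : ℝ} (ht : t ∈ T) (hf : IsRightDense T t → ContinuousWithinAt f T t) :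
    HasDeltaDerivAt T (fun s => ∫ u in b..s, f (lastPoint T b u)) (f t) t := by
  by_cases hd : IsRightDense T t
  · rw [hasDeltaDerivAt_iff_isLittleO, Asymptotics.isLittleO_iff]
    intro ε hε
    rw [(hd : sigma T t = t)]
    obtain ⟨δ, hδ, H⟩ := (Metric.nhdsWithin_basis_ball.eventually_iff).1
      (Metric.tendsto_nhds.1 (hf hd) ε hε)
    refine (Metric.nhdsWithin_basis_ball.eventually_iff).2 ⟨δ, hδ, fun s hs => ?_⟩
    have e : (∫ u in b..t, f (lastPoint T b u)) - (∫ u in b..s, f (lastPoint T b u))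
        - (t - s) • f t = ∫ u in s..t, (f (lastPoint T b u) - f t) := by
      rw [intervalIntegral.integral_interval_sub_left (hint _ _) (hint _ _),
        intervalIntegral.integral_sub (hint _ _) intervalIntegrable_const,
        intervalIntegral.integral_const]
    rw [e]
    refine intervalIntegral.norm_integral_le_of_norm_le_const fun u hu => ?_
    rw [← dist_eq_norm]
    refine (H ⟨?_, lastPoint_mem hT hb.1 u⟩).le
    have hst : min s t ∈ T := by rcases min_choice s t with h | h <;> rw [h]; exacts [hs.2, ht]
    have h1 : min s t ≤ lastPoint T b u := le_lastPoint hst hu.1.le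
    have h2 : lastPoint T b u ≤ max s t :=
      (lastPoint_le hT hb.1 ((hb.2 hst).trans hu.1.le)).trans hu.2
    have h3 := abs_lt.1 (Real.dist_eq s t ▸ Metric.mem_ball.1 hs.1)
    rw [Metric.mem_ball, Real.dist_eq, abs_lt]
    constructor
    · have : t - δ < min s t := lt_min (by linarith) (by linarith)
      linarith
    · have : max s t < t + δ := max_lt (by linarith) (by linarith)
      linarith
  · refine hasDeltaDerivAt_of_sigma_ne
      (intervalIntegral.continuous_primitive hint b).continuousWithinAt hd ?_
    have hle := le_sigma hub t
    have e : ∫ u in t..sigma T t, f (lastPoint T b u) = (sigma T t - t) • f t := by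
      rw [← intervalIntegral.integral_const]
      refine intervalIntegral.integral_congr_Ioo_of_le hle fun u hu => ?_
      rw [lastPoint_of_mem_Ico hT hb ht hu.1.le hu.2]
    rw [← e, intervalIntegral.integral_add_adjacent_intervals (hint _ _) (hint _ _)]

end Antiderivative

/-! ### The forward initial value problem -/

section Picard

open MeasureTheory

variable {R : Type*} [NormedRing R] {T : Set ℝ} {A : ℝ → R} {b : ℝ}

theorem intervalIntegrable_mul_lastPoint [SecondCountableTopology R] (hT : IsClosed T)
    (hub : ¬ BddAbove T) (hb : b ∈ T) (hA : RdContinuous T A)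
    {Ψ : ℝ → R} (hΨ : ContinuousOn Ψ (Ici b)) (c d : ℝ) :
    IntervalIntegrable (fun u => A (lastPoint T b u) * Ψ (lastPoint T b u)) volume c d := by
  have hmax : Continuous fun u => Ψ (max b u) :=
    hΨ.comp_continuous (continuous_const.max continuous_id) fun u => le_max_left b u
  have heq : ∀ u, Ψ (max b (lastPoint T b u)) = Ψ (lastPoint T b u) := fun u => by
    rw [max_eq_right (le_lastPoint_left hb u)]
  refine intervalIntegrable_of_locally_bounded
    ((hA.aestronglyMeasurable_comp_lastPoint hT hub hb).mul ?_) ?_ c d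
  · have := hmax.comp_stronglyMeasurable (monotone_lastPoint hb).measurable.stronglyMeasurable
    simp only [heq] at this
    exact this.aestronglyMeasurable
  · intro d
    obtain ⟨M, hM0, hM⟩ := hA.exists_norm_lastPoint_le hT hub hb d
    obtain ⟨N, hN⟩ := (isCompact_Icc (a := b) (b := max b d)).exists_bound_of_continuousOn
      (hΨ.mono Icc_subset_Ici_self)
    refine ⟨M * N, fun u hu => (norm_mul_le _ _).trans ?_⟩
    refine mul_le_mul (hM u hu) (hN _ ⟨le_lastPoint_left hb u, ?_⟩) (norm_nonneg _) hM0
    exact (lastPoint_mem_inter hT hb u).2.trans (max_le_max le_rfl hu)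

variable [NormedAlgebra ℝ R]

/-- The terms `1, ∫ A, ∫ A ∫ A, …` of the Peano series of `X^Δ = A X`, `X(b) = 1`, defined for all
real arguments by freezing the integrands on the gaps of `T`. -/
noncomputable def peanoTerm (T : Set ℝ) (A : ℝ → R) (b : ℝ) : ℕ → ℝ → R
  | 0, _ => 1
  | k + 1, t => ∫ u in b..t, A (lastPoint T b u) * peanoTerm T A b k (lastPoint T b u)

/-- The exponential-series bound. The factor `‖1‖` appears because the norm of `R` is not assumed
to satisfy `‖1‖ = 1`, which fails for `0 × 0` matrices. -/
theorem norm_peanoTerm_le (hT : IsClosed T) (hb : b ∈ T) {c M : ℝ} (hM0 : 0 ≤ M)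
    (hM : ∀ u ≤ c, ‖A (lastPoint T b u)‖ ≤ M) (k : ℕ) :
    ∀ t, b ≤ t → t ≤ c →
      ‖peanoTerm T A b k t‖ ≤ ‖(1 : R)‖ * ((M * (t - b)) ^ k / (k.factorial : ℝ)) := by
  induction k with
  | zero => intro t _ _; simp [peanoTerm]
  | succ k ih =>
    intro t hbt htc
    have hint : ∫ u in b..t, M * (‖(1 : R)‖ * ((M * (u - b)) ^ k / (k.factorial : ℝ)))
        = ‖(1 : R)‖ * ((M * (t - b)) ^ (k + 1) / ((k + 1).factorial : ℝ)) := by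
      have e : ∀ u : ℝ, M * (‖(1 : R)‖ * ((M * (u - b)) ^ k / (k.factorial : ℝ)))
          = (M ^ (k + 1) * ‖(1 : R)‖ / (k.factorial : ℝ)) * (u - b) ^ k := fun u => by
        rw [mul_pow]; ring
      simp only [e]
      rw [intervalIntegral.integral_const_mul,
        intervalIntegral.integral_comp_sub_right (fun u => u ^ k), integral_pow, sub_self,
        Nat.factorial_succ, mul_pow]
      have : (k.factorial : ℝ) ≠ 0 := by positivity
      push_cast
      field_simp
      ring
    rw [← hint]
    refine intervalIntegral.norm_integral_le_of_norm_le hbt (ae_of_all _ fun u hu => ?_) ?_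
    · refine (norm_mul_le _ _).trans ?_
      have hle := lastPoint_le hT hb hu.1.le
      have hge := le_lastPoint_left hb u
      have huc : u ≤ c := hu.2.trans htc
      refine mul_le_mul (hM u huc) ((ih _ hge (hle.trans huc)).trans ?_) (norm_nonneg _) hM0
      have : 0 ≤ M * (lastPoint T b u - b) := mul_nonneg hM0 (sub_nonneg.2 hge)
      gcongr
    · exact (by fun_prop : Continuous fun u : ℝ =>
        M * (‖(1 : R)‖ * ((M * (u - b)) ^ k / (k.factorial : ℝ)))).intervalIntegrable _ _

variable [SecondCountableTopology R]

theorem continuous_peanoTerm (hT : IsClosed T) (hub : ¬ BddAbove T) (hb : b ∈ T)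
    (hA : RdContinuous T A) (k : ℕ) : Continuous (peanoTerm T A b k) := by
  induction k with
  | zero => exact continuous_const
  | succ k ih =>
    exact intervalIntegral.continuous_primitive
      (intervalIntegrable_mul_lastPoint hT hub hb hA ih.continuousOn) b

variable [CompleteSpace R]

/-- The sum of the Peano series solves the initial value problem on a time scale that starts at
`b`. -/
theorem exists_solution_of_isLeast (hT : IsClosed T) (hub : ¬ BddAbove T) (hb : IsLeast T b)
    (hA : RdContinuous T A) :
    ∃ X : ℝ → R, X b = 1 ∧ ∀ t ∈ T, HasDeltaDerivAt T X (A t * X t) t := by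
  set φ := peanoTerm T A b with hφ
  have hcont : ∀ k, Continuous (φ k) := continuous_peanoTerm hT hub hb.1 hA
  have hbound : ∀ c, ∃ v : ℕ → ℝ, Summable v ∧ (∀ k t, b ≤ t → t ≤ c → ‖φ k t‖ ≤ v k) := by
    intro c
    obtain ⟨M, hM0, hM⟩ := hA.exists_norm_lastPoint_le hT hub hb.1 c
    refine ⟨fun k => ‖(1 : R)‖ * ((M * (c - b)) ^ k / (k.factorial : ℝ)),
      (Real.summable_pow_div_factorial _).mul_left _, fun k t hbt htc => ?_⟩
    refine (norm_peanoTerm_le hT hb.1 hM0 hM k t hbt htc).trans ?_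
    have : 0 ≤ M * (t - b) := mul_nonneg hM0 (sub_nonneg.2 hbt)
    dsimp only
    gcongr
  set X : ℝ → R := fun t => ∑' k, φ k t with hX
  have hsum : ∀ t, b ≤ t → HasSum (fun k => φ k t) (X t) := by
    intro t hbt
    obtain ⟨v, hv, hvb⟩ := hbound t
    exact (Summable.of_norm_bounded hv fun k => hvb k t hbt le_rfl).hasSum
  have hXc : ContinuousOn X (Ici b) := by
    intro t ht
    obtain ⟨v, hv, hvb⟩ := hbound (t + 1)
    have h1 : ContinuousOn X (Icc b (t + 1)) :=
      continuousOn_tsum (fun k => (hcont k).continuousOn) hv fun k s hs => hvb k s hs.1 hs.2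
    refine (h1 t ⟨ht, by linarith⟩).mono_of_mem_nhdsWithin ?_
    exact inter_mem_nhdsWithin _ (Iic_mem_nhds (by linarith))
  have hI := intervalIntegrable_mul_lastPoint hT hub hb.1 hA hXc
  have hint : ∀ t, b ≤ t →
      X t = 1 + ∫ u in b..t, A (lastPoint T b u) * X (lastPoint T b u) := by
    intro t hbt
    obtain ⟨v, hv, hvb⟩ := hbound t
    obtain ⟨M, hM0, hM⟩ := hA.exists_norm_lastPoint_le hT hub hb.1 t
    have h1 : HasSum (fun k => ∫ u in b..t, A (lastPoint T b u) * φ k (lastPoint T b u))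
        (∫ u in b..t, A (lastPoint T b u) * X (lastPoint T b u)) := by
      refine intervalIntegral.hasSum_integral_of_dominated_convergence (fun k _ => M * v k)
        (fun k => ?_) (fun k => ae_of_all _ fun u hu => ?_) (ae_of_all _ fun _ _ => hv.mul_left M)
        intervalIntegrable_const (ae_of_all _ fun u _ => ?_)
      · exact (intervalIntegrable_mul_lastPoint hT hub hb.1 hA
          (hcont k).continuousOn b t).def'.aestronglyMeasurable
      · rw [uIoc_of_le hbt] at hu
        refine (norm_mul_le _ _).trans (mul_le_mul (hM u hu.2) ?_ (norm_nonneg _) hM0)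
        exact hvb k _ (le_lastPoint_left hb.1 u) ((lastPoint_le hT hb.1 hu.1.le).trans hu.2)
      · exact (hsum _ (le_lastPoint_left hb.1 u)).mul_left _
    have h2 := ((hasSum_nat_add_iff' 1).2 (hsum t hbt)).unique h1
    rw [← h2]
    simp [hφ, peanoTerm]
  refine ⟨X, by simpa using hint b le_rfl, fun t ht => ?_⟩
  have hder := hasDeltaDerivAt_integral_lastPoint (f := fun t => A t * X t) hT hub hb hI ht
    fun hd => (hA.1 t ht hd).mul ((hXc t (hb.2 ht)).mono fun s hs => hb.2 hs)
  have := (hasDeltaDerivAt_const (1 : R)).add hder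
  rw [zero_add] at this
  exact this.congr_of_eqOn (fun s hs => hint s (hb.2 hs)) (sigma_mem hT hub t)

end Picard

/-! ### Solutions on the whole time scale -/

section Solutions

variable {R : Type*} [NormedRing R] [NormedAlgebra ℝ R] {T : Set ℝ} {A X Y : ℝ → R} {b c t : ℝ}

/-- `X` solves `X^Δ = A X` on the part of `T` from `b` onwards, regarded as a time scale of its
own, so that nothing is asked to the left of `b`. -/
def SolvesFrom (T : Set ℝ) (A : ℝ → R) (b : ℝ) (X : ℝ → R) : Prop :=
  ∀ t ∈ T, b ≤ t → HasDeltaDerivAt (T ∩ Ici b) X (A t * X t) t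

namespace SolvesFrom

theorem mono (h : SolvesFrom T A b X) (hbc : b ≤ c) : SolvesFrom T A c X := by
  intro t ht hct
  have := (h t ht (hbc.trans hct)).inter_Ici hct
  rwa [inter_assoc, Ici_inter_Ici, sup_eq_right.2 hbc] at this

theorem mul_const (h : SolvesFrom T A b X) (C : R) : SolvesFrom T A b fun t => X t * C := by
  intro t ht hbt
  have := (h t ht hbt).clm_comp ((ContinuousLinearMap.mul ℝ R).flip C)
  simpa [mul_assoc] using this

theorem continuousWithinAt (h : SolvesFrom T A b X) (ht : t ∈ T) (hbt : b ≤ t) :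
    ContinuousWithinAt X (T ∩ Ici b) t :=
  (h t ht hbt).continuousWithinAt ⟨ht, hbt⟩

/-- As long as the integral of a bound of `‖A‖` is at most `1/2`, a solution stays close to its
initial value. -/
theorem norm_sub_le (hT : IsClosed T) (hub : ¬ BddAbove T) (h : SolvesFrom T A b X) (hb : b ∈ T)
    (hc : c ∈ T) (hbc : b ≤ c) {M : ℝ} (hM : ∀ t ∈ T, b ≤ t → t ≤ c → ‖A t‖ ≤ M)
    (hsmall : M * (c - b) ≤ 1 / 2) : ‖X c - X b‖ ≤ 2 * (M * (c - b)) * ‖X b‖ := by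
  have hM0 : 0 ≤ M := (norm_nonneg _).trans (hM b hb le_rfl hbc)
  have := norm_sub_le_of_norm_deriv_le_mul (T := T ∩ Ici b) (f := X) (f' := fun t => A t * X t)
    (G := fun t => M * t) (g := fun _ => M) (hT.inter isClosed_Ici)
    (not_bddAbove_inter_Ici hub b) (⟨hb, self_mem_Ici⟩ : b ∈ T ∩ Ici b)
    (⟨hc, hbc⟩ : c ∈ T ∩ Ici b) hbc
    (fun t ht _ _ => h t ht.1 ht.2) (fun _ _ _ _ => hasDeltaDerivAt_mul_const M)
    (fun t ht _ htc => (norm_mul_le _ _).trans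
      (mul_le_mul_of_nonneg_right (hM t ht.1 ht.2 htc) (norm_nonneg _)))
    (fun _ _ _ _ => hM0) (by rwa [← mul_sub])
  rwa [← mul_sub] at this

theorem sub (hX : SolvesFrom T A b X) (hY : SolvesFrom T A b Y) :
    SolvesFrom T A b fun t => X t - Y t := by
  intro t ht hbt
  simpa [mul_sub] using (hX t ht hbt).sub (hY t ht hbt)

/-- A solution with zero initial value vanishes: the zero set is closed and has no last point, as
the solution stays zero over a gap, and over a short stretch by `norm_sub_le`. -/
theorem eq_zero (hT : IsClosed T) (hub : ¬ BddAbove T) (hA : RdContinuous T A)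
    (h : SolvesFrom T A b X) (hb : b ∈ T) (h0 : X b = 0) (hc : c ∈ T) (hbc : b ≤ c) :
    X c = 0 := by
  obtain ⟨M, hM0, hM⟩ := hA.exists_norm_le hT hub b c
  set s : Set ℝ := {t | t ∈ T ∧ X t = 0} with hs
  have hclosed : IsClosed (s ∩ Icc b c) := by
    have hXc : ContinuousOn X (T ∩ Icc b c) := fun t ht =>
      (h.continuousWithinAt ht.1 ht.2.1).mono
        (inter_subset_inter_right _ Icc_subset_Ici_self)
    have : s ∩ Icc b c = T ∩ Icc b c ∩ X ⁻¹' {0} := by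
      ext t
      simp only [hs, mem_inter_iff, mem_ofPred_eq, mem_preimage, mem_singleton_iff]
      tauto
    rw [this]
    exact hXc.preimage_isClosed_of_isClosed (hT.inter isClosed_Icc) isClosed_singleton
  refine (hclosed.mem_of_ge_of_forall_exists_gt ⟨hb, h0⟩ hbc ?_).2
  rintro x ⟨⟨hxT, hx⟩, hbx, hxc⟩
  by_cases hd : IsRightDense T x
  · obtain ⟨y, hyT, hxy, hy⟩ := exists_mem_Ioo_of_isRightDense hub hd
      (lt_min hxc (lt_add_of_pos_right x (show 0 < 1 / (2 * (M + 1)) by positivity)))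
    have hyc : y < c := hy.trans_le (min_le_left _ _)
    have hyd : y < x + 1 / (2 * (M + 1)) := hy.trans_le (min_le_right _ _)
    refine ⟨y, ⟨hyT, ?_⟩, hxy, hyc.le⟩
    have hsmall : M * (y - x) ≤ 1 / 2 := by
      have h1 : M * (y - x) ≤ (M + 1) * (1 / (2 * (M + 1))) := by gcongr <;> linarith
      have h2 : (M + 1) * (1 / (2 * (M + 1))) = 1 / 2 := by field_simp
      linarith
    have := (h.mono hbx).norm_sub_le hT hub hxT hyT hxy.le
      (fun t ht h1 h2 => hM t ht (hbx.trans h1) (h2.trans hyc.le)) hsmall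
    rw [hx, norm_zero, mul_zero, sub_zero] at this
    exact norm_le_zero_iff.1 this
  · have hlt : x < sigma T x := lt_of_le_of_ne (le_sigma hub x) (Ne.symm hd)
    refine ⟨sigma T x, ⟨sigma_mem hT hub x, ?_⟩, hlt, sigma_le hc hxc⟩
    have := (h x hxT hbx).sigma_eq ⟨hxT, hbx⟩
    rw [sigma_inter_Ici hbx, hx] at this
    simpa using this

theorem eq_of_eq (hT : IsClosed T) (hub : ¬ BddAbove T) (hA : RdContinuous T A)
    (hX : SolvesFrom T A b X) (hY : SolvesFrom T A b Y) (hb : b ∈ T) (h0 : X b = Y b)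
    (hc : c ∈ T) (hbc : b ≤ c) : X c = Y c :=
  sub_eq_zero.1 ((hX.sub hY).eq_zero hT hub hA hb (sub_eq_zero.2 h0) hc hbc)

end SolvesFrom

variable [CompleteSpace R] [SecondCountableTopology R]

theorem exists_solvesFrom (hT : IsClosed T) (hub : ¬ BddAbove T) (hA : RdContinuous T A)
    (hb : b ∈ T) : ∃ X : ℝ → R, X b = 1 ∧ SolvesFrom T A b X := by
  obtain ⟨X, h1, hX⟩ := exists_solution_of_isLeast (T := T ∩ Ici b) (A := A)
    (hT.inter isClosed_Ici) (not_bddAbove_inter_Ici hub b)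
    ⟨⟨hb, self_mem_Ici⟩, fun _ h => h.2⟩ (hA.inter_Ici b)
  exact ⟨X, h1, fun t ht hbt => hX t ⟨ht, hbt⟩⟩

/-- For a regressive coefficient the fundamental solution takes invertible values. At the first
point where this failed, invertibility would be inherited from the preceding point if there is a
gap, and otherwise from a nearby earlier point, over which the transition is close to `1`. -/
theorem SolvesFrom.isUnit (hT : IsClosed T) (hub : ¬ BddAbove T) (hA : RdContinuous T A)
    (hreg : ∀ t ∈ T, IsUnit (1 + graininess T t • A t)) (hX : SolvesFrom T A b X) (hb : b ∈ T)
    (h1 : X b = 1) (hc : c ∈ T) (hbc : b ≤ c) : IsUnit (X c) := by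
  by_contra hcon
  set N : Set ℝ := T ∩ Icc b c ∩ X ⁻¹' nonunits R with hN
  have hXc : ContinuousOn X (T ∩ Icc b c) := fun t ht =>
    (hX.continuousWithinAt ht.1 ht.2.1).mono (inter_subset_inter_right _ Icc_subset_Ici_self)
  have hK : IsCompact (T ∩ Icc b c) := isCompact_Icc.inter_left hT
  have hNc : IsCompact N :=
    hK.of_isClosed_subset (hXc.preimage_isClosed_of_isClosed hK.isClosed nonunits.isClosed)
      inter_subset_left
  obtain ⟨t, ⟨⟨htT, hbt, htc⟩, htN⟩, hmin⟩ := hNc.exists_isLeast ⟨c, ⟨hc, hbc, le_rfl⟩, hcon⟩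
  have hunit : ∀ s ∈ T, b ≤ s → s < t → IsUnit (X s) := by
    intro s hs hbs hst
    by_contra h
    exact absurd (hmin ⟨⟨hs, hbs, hst.le.trans htc⟩, h⟩) (not_le.2 hst)
  have hbt' : b < t := by
    refine lt_of_le_of_ne hbt fun h => htN ?_
    rw [← h, h1]
    exact isUnit_one
  refine htN ?_
  set r := sSup (T ∩ Iio t) with hr
  have hne : (T ∩ Iio t).Nonempty := ⟨b, hb, hbt'⟩
  have hbdd : BddAbove (T ∩ Iio t) := ⟨t, fun x hx => hx.2.le⟩
  have hrT : r ∈ T :=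
    hT.closure_subset (closure_mono inter_subset_left (csSup_mem_closure hne hbdd))
  have hbr : b ≤ r := le_csSup hbdd ⟨hb, hbt'⟩
  rcases (csSup_le hne fun x hx => hx.2.le : r ≤ t).lt_or_eq with hrt | hrt
  · have hσ : sigma T r = t := by
      refine le_antisymm (sigma_le htT hrt) (le_csInf (inter_Ioi_nonempty hub r) fun s hs => ?_)
      by_contra h
      exact absurd (le_csSup hbdd ⟨hs.1, not_le.1 h⟩) (not_le.2 hs.2)
    have h2 := (hX r hrT hbr).sigma_eq ⟨hrT, hbr⟩
    rw [sigma_inter_Ici hbr, hσ] at h2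
    have h3 : X t = (1 + graininess T r • A r) * X r := by
      rw [h2, graininess, hσ, add_mul, one_mul, smul_mul_assoc]
    rw [h3]
    exact (hreg r hrT).mul (hunit r hrT hbr hrt)
  · obtain ⟨M, hM0, hM⟩ := hA.exists_norm_le hT hub b c
    -- With this `δ` the transition over a distance of at most `δ` differs from `1` by less
    -- than `1`.
    set δ : ℝ := 1 / (2 * ((M + 1) * (‖(1 : R)‖ + 1))) with hδ
    have hδ0 : 0 < δ := by positivity
    obtain ⟨s, hs, hsr⟩ := exists_lt_of_lt_csSup hne
      (show max b (t - δ) < sSup (T ∩ Iio t) from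
        (max_lt hbt' (by linarith)).trans_eq hrt.symm)
    have hst : s < t := hs.2
    have hbs : b ≤ s := (le_max_left _ _).trans hsr.le
    have hsd : t - s ≤ δ := by have := (le_max_right b (t - δ)).trans hsr.le; linarith
    obtain ⟨Y, hY1, hY⟩ := exists_solvesFrom hT hub hA hs.1
    have hXY : X t = Y t * X s :=
      (hX.mono hbs).eq_of_eq hT hub hA (hY.mul_const (X s)) hs.1 (by rw [hY1, one_mul]) htT hst.le
    have hMδ : M * (t - s) * (‖(1 : R)‖ + 1) < 1 / 2 := by
      have e : (M + 1) * δ * (‖(1 : R)‖ + 1) = 1 / 2 := by rw [hδ]; field_simp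
      rw [← e]
      have : M * (t - s) < (M + 1) * δ := by nlinarith
      gcongr
    have hMs0 : 0 ≤ M * (t - s) := mul_nonneg hM0 (by linarith)
    have hsmall : M * (t - s) ≤ 1 / 2 := by nlinarith [norm_nonneg (1 : R)]
    have hnear := hY.norm_sub_le hT hub hs.1 htT hst.le
      (fun u hu h1 h2 => hM u hu (hbs.trans h1) (h2.trans htc)) hsmall
    rw [hY1] at hnear
    have hYu : IsUnit (Y t) := by
      have hlt : ‖1 - Y t‖ < 1 := by rw [norm_sub_rev]; nlinarith
      simpa using isUnit_one_sub_of_norm_lt_one hlt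
    rw [hXY]
    exact hYu.mul (hunit s hs.1 hbs hst)

/-- The initial value problem at `a` has a solution on all of `T`. To the left of `a` it is obtained
from the fundamental solutions that start at points `m ≤ a`, normalised at `a`. -/
theorem exists_solution (hT : IsClosed T) (hub : ¬ BddAbove T) (hA : RdContinuous T A)
    (hreg : ∀ t ∈ T, IsUnit (1 + graininess T t • A t)) {a : ℝ} (ha : a ∈ T) :
    ∃ X : ℝ → R, X a = 1 ∧ ∀ t ∈ T, HasDeltaDerivAt T X (A t * X t) t := by
  have hex : ∀ b, ∃ Y : ℝ → R, b ∈ T → Y b = 1 ∧ SolvesFrom T A b Y := by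
    intro b
    by_cases hb : b ∈ T
    · obtain ⟨Y, hY⟩ := exists_solvesFrom hT hub hA hb
      exact ⟨Y, fun _ => hY⟩
    · exact ⟨0, fun h => absurd h hb⟩
  choose Φ hΦ using hex
  have hunit : ∀ b ∈ T, ∀ c ∈ T, b ≤ c → IsUnit (Φ b c) := fun b hb c hc hbc =>
    (hΦ b hb).2.isUnit hT hub hA hreg hb (hΦ b hb).1 hc hbc
  have hco : ∀ b ∈ T, ∀ m ∈ T, ∀ t ∈ T, b ≤ m → m ≤ t → Φ b t = Φ m t * Φ b m := by
    intro b hb m hm t ht hbm hmt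
    exact ((hΦ b hb).2.mono hbm).eq_of_eq hT hub hA ((hΦ m hm).2.mul_const _) hm
      (by rw [(hΦ m hm).1, one_mul]) ht hmt
  have hmin : ∀ t ∈ T, min t a ∈ T := fun t ht => by
    rcases min_choice t a with h | h <;> rw [h]
    exacts [ht, ha]
  set X : ℝ → R := fun t => Φ (min t a) t * Ring.inverse (Φ (min t a) a) with hX
  -- By uniqueness, `X t` does not depend on the starting point of the fundamental solution.
  have key : ∀ b ∈ T, b ≤ a → ∀ t ∈ T, b ≤ t → X t = Φ b t * Ring.inverse (Φ b a) := by
    intro b hb hba t ht hbt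
    have hm := hmin t ht
    have hbm : b ≤ min t a := le_min hbt hba
    obtain ⟨u, hu⟩ := hunit b hb _ hm hbm
    obtain ⟨v, hv⟩ := hunit _ hm a ha (min_le_right t a)
    rw [hco b hb _ hm t ht hbm (min_le_left _ _), hco b hb _ hm a ha hbm (min_le_right _ _)]
    simp only [hX]
    rw [← hu, ← hv, ← Units.val_mul, Ring.inverse_unit, Ring.inverse_unit, mul_inv_rev,
      Units.val_mul, mul_assoc, Units.mul_inv_cancel_left]
  refine ⟨X, ?_, fun t ht => ?_⟩
  · rw [key a ha le_rfl a ha le_rfl, (hΦ a ha).1, Ring.inverse_one, one_mul]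
  · obtain ⟨b, hb, hba, hbt, hor⟩ : ∃ b ∈ T, b ≤ a ∧ b ≤ t ∧ (b < t ∨ T ⊆ Ici b) := by
      by_cases h : ∃ s ∈ T, s < min t a
      · obtain ⟨s, hs, hlt⟩ := h
        exact ⟨s, hs, (hlt.trans_le (min_le_right _ _)).le, (hlt.trans_le (min_le_left _ _)).le,
          Or.inl (hlt.trans_le (min_le_left _ _))⟩
      · push Not at h
        exact ⟨_, hmin t ht, min_le_right _ _, min_le_left _ _, Or.inr h⟩
    have h1 := (hΦ b hb).2.mul_const (Ring.inverse (Φ b a)) t ht hbt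
    dsimp only at h1
    rw [← key b hb hba t ht hbt] at h1
    refine (h1.congr_of_eqOn (fun s hs => key b hb hba s hs.1 hs.2) ?_).of_inter_Ici hbt hor
    rw [sigma_inter_Ici hbt]
    exact ⟨sigma_mem hT hub t, hbt.trans (le_sigma hub t)⟩

end Solutions

/-! ### Asymptotics of solutions -/

section Asymptotics

/-- If `‖f^Δ‖ ≤ g ‖f‖` with a nonnegative `g` of convergent integral, then `f` has a limit: it is
bounded, and its oscillation is controlled by that of the antiderivative `G` of `g`. -/
theorem exists_tendsto_of_norm_deriv_le_mul {E : Type*} [NormedAddCommGroup E] [NormedSpace ℝ E]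
    [CompleteSpace E] {T : Set ℝ} {f f' : ℝ → E} {G g : ℝ → ℝ} {b l : ℝ} (hT : IsClosed T)
    (hub : ¬ BddAbove T) (hb : b ∈ T) (hf : ∀ t ∈ T, b ≤ t → HasDeltaDerivAt T f (f' t) t)
    (hG : ∀ t ∈ T, b ≤ t → HasDeltaDerivAt T G (g t) t)
    (hfg : ∀ t ∈ T, b ≤ t → ‖f' t‖ ≤ g t * ‖f t‖) (hg : ∀ t ∈ T, b ≤ t → 0 ≤ g t)
    (hsmall : ∀ s ∈ T, ∀ t ∈ T, b ≤ s → s ≤ t → G t - G s ≤ 1 / 2)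
    (hlim : Tendsto G (atInfty T) (𝓝 l)) : ∃ L, Tendsto f (atInfty T) (𝓝 L) := by
  have hest : ∀ s ∈ T, ∀ t ∈ T, b ≤ s → s ≤ t → ‖f t - f s‖ ≤ 2 * (G t - G s) * ‖f s‖ :=
    fun s hs t ht hbs hst => norm_sub_le_of_norm_deriv_le_mul hT hub hs ht hst
      (fun u hu h _ => hf u hu (hbs.trans h)) (fun u hu h _ => hG u hu (hbs.trans h))
      (fun u hu h _ => hfg u hu (hbs.trans h)) (fun u hu h _ => hg u hu (hbs.trans h))
      (hsmall s hs t ht hbs hst)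
  have hbound : ∀ t ∈ T, b ≤ t → ‖f t‖ ≤ 2 * ‖f b‖ := by
    intro t ht hbt
    have h1 := hest b hb t ht le_rfl hbt
    have h2 := hsmall b hb t ht le_rfl hbt
    have h3 : ‖f t‖ ≤ ‖f t - f b‖ + ‖f b‖ := by
      simpa using norm_add_le (f t - f b) (f b)
    nlinarith [norm_nonneg (f b)]
  have := atInfty_neBot hub
  refine CompleteSpace.complete (Metric.cauchy_iff.2 ⟨inferInstance, fun ε hε => ?_⟩)
  set κ : ℝ := ε / (8 * (‖f b‖ + 1)) with hκ
  have hκ0 : 0 < κ := by positivity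
  obtain ⟨t₁, -, h₁⟩ := exists_of_eventually_atInfty hub
    ((Metric.tendsto_nhds.1 hlim κ hκ0).and (eventually_atInfty_ge b))
  have hclose : ∀ s ∈ T, ∀ t ∈ T, t₁ ≤ s → s ≤ t → dist (f t) (f s) < ε := by
    intro s hs t ht h1s hst
    obtain ⟨hGs, -, hbs⟩ := h₁ s hs h1s
    obtain ⟨hGt, -, -⟩ := h₁ t ht (h1s.trans hst)
    rw [Real.dist_eq, abs_lt] at hGs hGt
    rw [dist_eq_norm]
    have h2 := hest s hs t ht hbs hst
    have h3 : 2 * (G t - G s) * ‖f s‖ ≤ 2 * (2 * κ) * (2 * ‖f b‖) :=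
      mul_le_mul (by linarith) (hbound s hs hbs) (norm_nonneg _) (by positivity)
    have h4 : 8 * κ * (‖f b‖ + 1) = ε := by rw [hκ]; field_simp
    nlinarith
  refine ⟨_, image_mem_map (eventually_atInfty_ge t₁), ?_⟩
  rintro _ ⟨s, ⟨hs, h1s⟩, rfl⟩ _ ⟨t, ⟨ht, h1t⟩, rfl⟩
  rcases le_total s t with h | h
  · rw [dist_comm]; exact hclose s hs t ht h1s h
  · exact hclose t ht s hs h1t h

variable {R : Type*} [NormedRing R] [NormedAlgebra ℝ R] [CompleteSpace R] {T : Set ℝ}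

/-- The delta derivative of `Y = P⁻¹ X`, from `P^σ Y^Δ = X^Δ - P^Δ Y`. -/
theorem hasDeltaDerivAt_inverse_mul {P X : ℝ → R} {P' X' : R} {t : ℝ} (ht : t ∈ T)
    (hP : HasDeltaDerivAt T P P' t) (hX : HasDeltaDerivAt T X X' t) (hu : IsUnit (P t))
    (huσ : IsUnit (P (sigma T t))) :
    HasDeltaDerivAt T (fun s => Ring.inverse (P s) * X s)
      (Ring.inverse (P (sigma T t)) * (X' - P' * (Ring.inverse (P t) * X t))) t := by
  set Y : ℝ → R := fun s => Ring.inverse (P s) * X s with hY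
  have hPc := hP.continuousWithinAt ht
  have hinv : ContinuousWithinAt (fun s => Ring.inverse (P s)) T t := by
    obtain ⟨u, hu'⟩ := hu
    refine ContinuousAt.comp_continuousWithinAt (g := Ring.inverse) ?_ hPc
    rw [← hu']
    exact NormedRing.inverse_continuousAt u
  have hYc : ContinuousWithinAt Y T t := hinv.mul (hX.continuousWithinAt ht)
  have hev : ∀ᶠ s in 𝓝[T] t, IsUnit (P s) := hPc.eventually (Units.isOpen.mem_nhds hu)
  rw [hasDeltaDerivAt_iff_isLittleO] at hP hX ⊢
  set σ := sigma T t
  have h2 : (fun s => (P σ - P s - (σ - s) • P') * Y s) =o[𝓝[T] t] fun s => σ - s := by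
    simpa using hP.mul_isBigO (hYc.tendsto.isBigO_one ℝ)
  have h3 : (fun s => (σ - s) • (P' * (Y s - Y t))) =o[𝓝[T] t] fun s => σ - s := by
    have h0 : Tendsto (fun s => P' * (Y s - Y t)) (𝓝[T] t) (𝓝 0) := by
      simpa using (hYc.tendsto.sub_const (Y t)).const_mul P'
    simpa using (Asymptotics.isBigO_refl (fun s => σ - s) (𝓝[T] t)).smul_isLittleO
      ((Asymptotics.isLittleO_one_iff ℝ).2 h0)
  have h4 := ((hX.sub h2).sub h3).const_mul_left (Ring.inverse (P σ))
  refine h4.congr' (hev.mono fun s hs => ?_) EventuallyEq.rfl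
  have e1 : X s = P s * Y s := by
    rw [hY]; dsimp only; rw [← mul_assoc, Ring.mul_inverse_cancel _ hs, one_mul]
  have e2 : Ring.inverse (P σ) * (P σ * Y s) = Y s := by
    rw [← mul_assoc, Ring.inverse_mul_cancel _ huσ, one_mul]
  have e3 : Ring.inverse (P σ) * X σ = Y σ := rfl
  have e4 : Ring.inverse (P t) * X t = Y t := rfl
  have e5 : X σ - X s - (σ - s) • X' - (P σ - P s - (σ - s) • P') * Y s
      - (σ - s) • (P' * (Y s - Y t))
      = X σ - P σ * Y s - (σ - s) • (X' - P' * Y t) := by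
    rw [e1]
    simp only [sub_mul, mul_sub, smul_sub, smul_mul_assoc]
    abel
  dsimp only
  rw [e5, e4, mul_sub, mul_sub, mul_smul_comm, e2, e3]

variable {A : ℝ → R} {a : ℝ}

/-- The substitution `X = P Y` with `P = 1 - ∫_t^∞ A + ∫_t^∞ A ∫_s^∞ A` satisfies
`P^Δ = A P - A ∫_t^∞ A ∫_s^∞ A`, so that it turns `X^Δ = A X` into a system whose coefficient is
absolutely integrable. Here `g` is a constant multiple of `‖A ∫_t^∞ A ∫_s^∞ A‖`, and `t₀` is taken
so late that the integral of `g` from there on is at most `κ`. -/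
theorem exists_transformation (hT : IsClosed T) (hub : ¬ BddAbove T)
    (h1 : ImproperConverges T A a)
    (h2 : ImproperConverges T (fun t => A t * improperIntegral T A t) a)
    (h3 : ImproperConvergesAbs T (fun t => A t * improperIntegral T
      (fun s => A s * improperIntegral T A s) t) a) {κ : ℝ} (hκ : 0 < κ) :
    ∃ (P : ℝ → R) (G g : ℝ → ℝ) (l : ℝ), ∃ t₀ ∈ T, Tendsto P (atInfty T) (𝓝 1) ∧
      (∀ t ∈ T, t₀ ≤ t → IsUnit (P t)) ∧
      (∀ t ∈ T, HasDeltaDerivAt T G (g t) t) ∧ (∀ t, 0 ≤ g t) ∧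
      Tendsto G (atInfty T) (𝓝 l) ∧
      (∀ s ∈ T, ∀ t ∈ T, t₀ ≤ s → s ≤ t → G t - G s ≤ κ) ∧
      ∀ X : ℝ → R, (∀ t ∈ T, HasDeltaDerivAt T X (A t * X t) t) →
        ∃ Y' : ℝ → R, ∀ t ∈ T, t₀ ≤ t →
          HasDeltaDerivAt T (fun s => Ring.inverse (P s) * X s) (Y' t) t ∧
          ‖Y' t‖ ≤ g t * ‖Ring.inverse (P t) * X t‖ := by
  obtain ⟨hd1, hl1⟩ := h1.improperIntegral_tail hT hub
  obtain ⟨hd2, hl2⟩ := h2.improperIntegral_tail hT hub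
  obtain ⟨I, G₀, hG₀, hlim⟩ := h3
  set A₁ := improperIntegral T A
  set A₂ := improperIntegral T (fun t => A t * A₁ t)
  set P : ℝ → R := fun t => 1 - A₁ t + A₂ t with hP
  have hP1 : Tendsto P (atInfty T) (𝓝 1) := by
    simpa using (hl1.const_sub (1 : R)).add hl2
  have hPd : ∀ t ∈ T, HasDeltaDerivAt T P (A t * P t - A t * A₂ t) t := by
    intro t ht
    have := ((hasDeltaDerivAt_const (1 : R)).sub (hd1 t ht)).add (hd2 t ht)
    convert! this using 1
    simp only [hP, mul_add, mul_sub, mul_one]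
    abel
  have hinv : Tendsto (fun t => Ring.inverse (P t)) (atInfty T) (𝓝 1) := by
    have := (NormedRing.inverse_continuousAt (1 : Rˣ)).tendsto
    rw [Units.val_one, Ring.inverse_one] at this
    exact this.comp hP1
  set C : ℝ := ‖(1 : R)‖ + 1 with hC
  have hC0 : 0 ≤ C := by positivity
  have hG₀l : Tendsto (fun t => C * G₀ t) (atInfty T) (𝓝 (C * (I + G₀ a))) := by
    simpa using (hlim.add_const (G₀ a)).const_mul C
  obtain ⟨t₀, ht₀, H⟩ := exists_of_eventually_atInfty hub
    (((hP1.eventually (Units.isOpen.mem_nhds isUnit_one)).and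
      (hinv.norm.eventually (gt_mem_nhds (lt_add_one ‖(1 : R)‖)))).and
      (Metric.tendsto_nhds.1 hG₀l (κ / 2) (half_pos hκ)))
  refine ⟨P, fun t => C * G₀ t, fun t => C * ‖A t * A₂ t‖, _, t₀, ht₀, hP1,
    fun t ht h => (H t ht h).1.1,
    fun t ht => (hG₀ t ht).clm_comp (ContinuousLinearMap.mul ℝ ℝ C),
    fun t => mul_nonneg hC0 (norm_nonneg _), hG₀l, ?_, fun X hX => ?_⟩
  · intro s hs t ht h0s hst
    have e1 := (H s hs h0s).2
    have e2 := (H t ht (h0s.trans hst)).2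
    rw [Real.dist_eq, abs_lt] at e1 e2
    linarith
  · refine ⟨_, fun t ht h0t => ⟨hasDeltaDerivAt_inverse_mul ht (hPd t ht) (hX t ht)
      (H t ht h0t).1.1 (H _ (sigma_mem hT hub t) (h0t.trans (le_sigma hub t))).1.1, ?_⟩⟩
    have e1 : X t = P t * (Ring.inverse (P t) * X t) := by
      rw [← mul_assoc, Ring.mul_inverse_cancel _ (H t ht h0t).1.1, one_mul]
    have e2 : A t * X t - (A t * P t - A t * A₂ t) * (Ring.inverse (P t) * X t)
        = A t * A₂ t * (Ring.inverse (P t) * X t) := by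
      rw [sub_mul, mul_assoc (A t) (P t), ← e1, sub_sub_cancel]
    rw [e2, mul_assoc C]
    refine (norm_mul_le _ _).trans ?_
    exact mul_le_mul (H _ (sigma_mem hT hub t) (h0t.trans (le_sigma hub t))).1.2.le
      (norm_mul_le _ _) (norm_nonneg _) hC0

theorem exists_tendsto_of_solution (hT : IsClosed T) (hub : ¬ BddAbove T)
    (h1 : ImproperConverges T A a)
    (h2 : ImproperConverges T (fun t => A t * improperIntegral T A t) a)
    (h3 : ImproperConvergesAbs T (fun t => A t * improperIntegral T
      (fun s => A s * improperIntegral T A s) t) a) {X : ℝ → R}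
    (hX : ∀ t ∈ T, HasDeltaDerivAt T X (A t * X t) t) :
    ∃ L, Tendsto X (atInfty T) (𝓝 L) := by
  obtain ⟨P, G, g, l, t₀, ht₀, hP, hu, hG, hg, hl, hκ, H⟩ :=
    exists_transformation hT hub h1 h2 h3 (show (0 : ℝ) < 1 / 2 by norm_num)
  obtain ⟨Y', hY'⟩ := H X hX
  obtain ⟨L, hL⟩ := exists_tendsto_of_norm_deriv_le_mul hT hub ht₀
    (fun t ht h => (hY' t ht h).1) (fun t ht _ => hG t ht) (fun t ht h => (hY' t ht h).2)
    (fun t _ _ => hg t) hκ hl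
  refine ⟨1 * L, (hP.mul hL).congr' ((eventually_atInfty_ge t₀).mono fun t ht => ?_)⟩
  rw [Ring.mul_inverse_cancel_left _ _ (hu t ht.1 ht.2)]

/-- Started far enough out at the value of the transformation `P`, the transformed solution starts
at `1` and stays close to it, so that its limit is invertible and can be normalised. -/
theorem exists_solution_tendsto_one [SecondCountableTopology R] (hT : IsClosed T)
    (hub : ¬ BddAbove T) (hA : RdContinuous T A)
    (hreg : ∀ t ∈ T, IsUnit (1 + graininess T t • A t))
    (h1 : ImproperConverges T A a)
    (h2 : ImproperConverges T (fun t => A t * improperIntegral T A t) a)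
    (h3 : ImproperConvergesAbs T (fun t => A t * improperIntegral T
      (fun s => A s * improperIntegral T A s) t) a) :
    ∃ X : ℝ → R, (∀ t ∈ T, HasDeltaDerivAt T X (A t * X t) t) ∧
      Tendsto X (atInfty T) (𝓝 1) := by
  set κ : ℝ := 1 / (4 * (‖(1 : R)‖ + 1)) with hκ
  have hκ0 : 0 < κ := by positivity
  have hκ1 : κ * (‖(1 : R)‖ + 1) = 1 / 4 := by rw [hκ]; field_simp
  have hκ2 : κ ≤ 1 / 2 := by nlinarith [norm_nonneg (1 : R)]
  obtain ⟨P, G, g, l, t₀, ht₀, hP, hu, hG, hg, hl, hGκ, H⟩ :=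
    exists_transformation hT hub h1 h2 h3 hκ0
  obtain ⟨Φ, hΦ1, hΦ⟩ := exists_solution hT hub hA hreg ht₀
  have hmul : ∀ (Z : ℝ → R), (∀ t ∈ T, HasDeltaDerivAt T Z (A t * Z t) t) → ∀ C : R,
      ∀ t ∈ T, HasDeltaDerivAt T (fun t => Z t * C) (A t * (Z t * C)) t := by
    intro Z hZ C t ht
    simpa [mul_assoc] using (hZ t ht).clm_comp ((ContinuousLinearMap.mul ℝ R).flip C)
  have hX := hmul Φ hΦ (P t₀)
  obtain ⟨L, hL⟩ := exists_tendsto_of_solution hT hub h1 h2 h3 hX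
  obtain ⟨Y', hY'⟩ := H _ hX
  have hY0 : Ring.inverse (P t₀) * (Φ t₀ * P t₀) = 1 := by
    rw [hΦ1, one_mul, Ring.inverse_mul_cancel _ (hu t₀ ht₀ le_rfl)]
  have hinv : Tendsto (fun t => Ring.inverse (P t)) (atInfty T) (𝓝 1) := by
    have := (NormedRing.inverse_continuousAt (1 : Rˣ)).tendsto
    rw [Units.val_one, Ring.inverse_one] at this
    exact this.comp hP
  have hYL : Tendsto (fun t => Ring.inverse (P t) * (Φ t * P t₀)) (atInfty T) (𝓝 L) := by
    simpa using hinv.mul hL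
  have hnear : ∀ t ∈ T, t₀ ≤ t → ‖Ring.inverse (P t) * (Φ t * P t₀) - 1‖ ≤ 1 / 2 := by
    intro t ht h0t
    have := norm_sub_le_of_norm_deriv_le_mul hT hub ht₀ ht h0t
      (fun u hu h _ => (hY' u hu h).1) (fun u hu _ _ => hG u hu)
      (fun u hu h _ => (hY' u hu h).2) (fun u _ _ _ => hg u)
      ((hGκ t₀ ht₀ t ht le_rfl h0t).trans hκ2)
    rw [hY0] at this
    have h5 := hGκ t₀ ht₀ t ht le_rfl h0t
    nlinarith [norm_nonneg (1 : R)]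
  have := atInfty_neBot hub
  have hL1 : ‖L - 1‖ ≤ 1 / 2 := le_of_tendsto (hYL.sub_const 1).norm
    ((eventually_atInfty_ge t₀).mono fun t ht => hnear t ht.1 ht.2)
  have hLu : IsUnit L := by
    have hlt : ‖1 - L‖ < 1 := by rw [norm_sub_rev]; linarith
    simpa using isUnit_one_sub_of_norm_lt_one hlt
  refine ⟨_, hmul _ hX (Ring.inverse L), ?_⟩
  have := hL.mul_const (Ring.inverse L)
  rwa [Ring.mul_inverse_cancel _ hLu] at this

end Asymptotics

/-! ### Vector solutions -/

section Vector

variable {𝕜 : Type*} [RCLike 𝕜] {n : ℕ} {T : Set ℝ} {A : ℝ → Matrix (Fin n) (Fin n) 𝕜}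

attribute [local instance] Matrix.linftyOpNormedRing Matrix.linftyOpNormedAlgebra

theorem IsSolution.replicateCol {x : ℝ → Fin n → 𝕜} (hx : IsSolution T A x) :
    ∀ t ∈ T, HasDeltaDerivAt T (fun s => Matrix.replicateCol (Fin n) (x s))
      (A t * Matrix.replicateCol (Fin n) (x t)) t := by
  intro t ht
  let L : (Fin n → 𝕜) →ₗ[ℝ] Matrix (Fin n) (Fin n) 𝕜 :=
    { toFun := Matrix.replicateCol (Fin n)
      map_add' := fun _ _ => rfl
      map_smul' := fun _ _ => rfl }
  have := (hx t ht).clm_comp L.toContinuousLinearMap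
  rw [← Matrix.replicateCol_mulVec]
  exact this

/-- Multiplication of a matrix by a fixed vector, as a continuous real-linear map. -/
noncomputable def mulVecCLM (v : Fin n → 𝕜) : Matrix (Fin n) (Fin n) 𝕜 →L[ℝ] (Fin n → 𝕜) :=
  LinearMap.toContinuousLinearMap
    { toFun := fun M => M.mulVec v
      map_add' := fun M N => Matrix.add_mulVec M N v
      map_smul' := fun c M => Matrix.smul_mulVec c M v }

theorem isSolution_mulVec {X : ℝ → Matrix (Fin n) (Fin n) 𝕜}
    (hX : ∀ t ∈ T, HasDeltaDerivAt T X (A t * X t) t) (v : Fin n → 𝕜) :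
    IsSolution T A fun t => (X t).mulVec v := by
  intro t ht
  have := (hX t ht).clm_comp (mulVecCLM v)
  change HasDeltaDerivAt T _ ((A t * X t).mulVec v) t at this
  rw [← Matrix.mulVec_mulVec] at this
  exact this

/-- Class (S) follows from its matrix counterpart: convergence of all matrix solutions, and one
matrix solution tending to `1`. -/
theorem classS_of_matrix
    (hlim : ∀ X : ℝ → Matrix (Fin n) (Fin n) 𝕜, (∀ t ∈ T, HasDeltaDerivAt T X (A t * X t) t) →
      ∃ L, Tendsto X (atInfty T) (𝓝 L))
    (hone : ∃ X : ℝ → Matrix (Fin n) (Fin n) 𝕜,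
      (∀ t ∈ T, HasDeltaDerivAt T X (A t * X t) t) ∧ Tendsto X (atInfty T) (𝓝 1)) :
    ClassS T A := by
  refine ⟨fun x hx => ?_, fun v => ?_⟩
  · obtain ⟨L, hL⟩ := hlim _ hx.replicateCol
    exact ⟨fun i => L i i, tendsto_pi_nhds.2 fun i => tendsto_pi_nhds.1 (tendsto_pi_nhds.1 hL i) i⟩
  · obtain ⟨X, hX, hX1⟩ := hone
    refine ⟨_, isSolution_mulVec hX v, ?_⟩
    have := ((mulVecCLM v).continuous.tendsto 1).comp hX1
    change Tendsto _ _ (𝓝 ((1 : Matrix (Fin n) (Fin n) 𝕜).mulVec v)) at this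
    rw [Matrix.one_mulVec] at this
    exact this

end Vector

end TimeScale

theorem theorem3 {𝕜 : Type*} [RCLike 𝕜] {n : ℕ} (T : Set ℝ)
    (hT : TimeScale.IsTimeScale T) (hT_unbdd : ¬ BddAbove T)
    (A : ℝ → Matrix (Fin n) (Fin n) 𝕜)
    (hA_rd : TimeScale.RdContinuous T A) (hA_reg : TimeScale.Regressive T A)
    (a : ℝ) (ha : a ∈ T)
    (h1 : TimeScale.ImproperConverges T A a)
    (h2 : TimeScale.ImproperConverges T
      (fun t => A t * TimeScale.improperIntegral T A t) a)
    (h3 : TimeScale.ImproperConvergesAbs T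
      (fun t => A t * TimeScale.improperIntegral T
        (fun s => A s * TimeScale.improperIntegral T A s) t) a) :
    TimeScale.ClassS T A := by
  let : NormedRing (Matrix (Fin n) (Fin n) 𝕜) := Matrix.linftyOpNormedRing
  let : NormedAlgebra ℝ (Matrix (Fin n) (Fin n) 𝕜) := Matrix.linftyOpNormedAlgebra
  have : CompleteSpace (Matrix (Fin n) (Fin n) 𝕜) := FiniteDimensional.complete ℝ _
  have : ProperSpace (Matrix (Fin n) (Fin n) 𝕜) := FiniteDimensional.proper ℝ _
  exact TimeScale.classS_of_matrix
    (fun X hX => TimeScale.exists_tendsto_of_solution hT.isClosed hT_unbdd h1 h2 h3 hX)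
    (TimeScale.exists_solution_tendsto_one hT.isClosed hT_unbdd hA_rd hA_reg h1 h2 h3)
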